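/- **Data.** Let $n,m,d\ge 1$. For $k\in\mathbb N_0$ let $A_k\in\mathbb R^{n\times n}$, $B_k\in\mathbb R^{n\times m}$, $Q_k\succeq 0$, $R_k\succ 0$ be such that $\|A_k\|_2,\|B_k\|_2,\|Q_k\|_2,\|R_k\|_2$ are bounded uniformly in $k$ and every $A_k$ is non-singular; put $C_k=Q_k^{1/2}$ and $\Theta_{k,j}=A_{k+j-1}\cdots A_k$ ($\Theta_{k,0}=I$). Suppose that for all $k$ the matrix $[\Theta_{k+1,d-1}B_k\ \ \Theta_{k+2,d-2}B_{k+1}\ \cdots\ \Theta_{k+d,0}B_{k+d-1}]$ has full row rank and the matrix with block rows $C_{k+i}\Theta_{k,i}$, $i=0,\dots,d$, has full column rank. **Lifted data.** For $t\in\mathbb N_0$ let $$\hat A_t=I_{n(d+1)}-\begin{bmatrix}0&0\\ \mathrm{diag}(A_{dt},\dots,A_{d(t+1)-1})&0\end{bmatrix},\quad \hat B_t=\begin{bmatrix}0\\ \mathrm{diag}(B_{dt},\dots,B_{d(t+1)-1})\end{bmatrix},\quad \hat C_t=[\mathrm{diag}(C_{dt},\dots,C_{d(t+1)-1})\ \ 0],$$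 $\Phi_t=[0\ I_n]\hat A_t^{-1}[I_n\ 0]'$, $\Gamma_t=[0\ I_n]\hat A_t^{-1}\hat B_t$, $\Xi_t=\hat C_t\hat A_t^{-1}[I_n\ 0]'$, $\Delta_t=\hat C_t\hat A_t^{-1}\hat B_t$, and $$\tilde R_t=\mathrm{diag}(R_{dt},\dots,R_{dt+d-1})+\Delta_t'\Delta_t,\quad \tilde Q_t=\Xi_t'\Xi_t-\Xi_t'\Delta_t\tilde R_t^{-1}\Delta_t'\Xi_t,\quad \tilde A_t=\Phi_t-\Gamma_t\tilde R_t^{-1}\Delta_t'\Xi_t,\quad \tilde B_t=\Gamma_t .$$ Suppose $\inf_t\lambda_{\min}(\tilde Q_t)>0$, $\inf_t\lambda_{\min}(\tilde B_t\tilde B_t')>0$ and $\inf_t\lambda_{\min}(\tilde A_t\tilde A_t')>0$. **Costs and policies.** For inputs $w_j\in(\mathbb R^m)^d$ and $z_t=\chi$, $z_{j+1}=\tilde A_jz_j+\tilde B_jw_j$, let $J_T(t,\chi,w)=\sum_{j=t}^{t+T-1}(z_j'\tilde Q_jz_j+w_j'\tilde R_jw_j)$ and, for an input sequence $\tilde u$,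 $J(0,\xi,\tilde u)=\lim_{T\to\infty}J_T(0,\xi,\tilde u_{[0:T-1]})$. Let $$\mathcal R_t(P)=\tilde Q_t+\tilde A_t'\big(P-P\tilde B_t(\tilde R_t+\tilde B_t'P\tilde B_t)^{-1}\tilde B_t'P\big)\tilde A_t .$$ There is a unique bounded positive semi-definite sequence $(P_t)_{t\in\mathbb N_0}$ with $P_t=\mathcal R_t(P_{t+1})$ for all $t$; the feedback $\tilde u_t=-(\tilde R_t+\tilde B_t'P_{t+1}\tilde B_t)^{-1}\tilde B_t'P_{t+1}\tilde A_t\tilde x_t$ for the system $\tilde x_{t+1}=\tilde A_t\tilde x_t+\tilde B_t\tilde u_t$, $\tilde x_0=\xi$, generates an input $\tilde u^*$ that minimizes $J(0,\xi,\cdot)$. Fix $T\in\mathbb N$, $T\ge1$, and set $$X_{j}=\tilde Q_{j}+\tilde A_{j}'(\tilde B_{j}\tilde B_{j}')^{-1}\tilde B_{j}\tilde R_{j}\tilde B_{j}'(\tilde B_{j}\tilde B_{j}')^{-1}\tilde A_{j}\qquad (j\in\mathbb N_0).$$ The $T$-step receding-horizon policy applies, at time $t$ and state $\tilde x_t$,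 the first entry $\tilde u_t$ of the (well-defined) minimizer over $w\in((\mathbb R^m)^d)^T$ of $J_T(t,\tilde x_t,w)+z_{t+T}'X_{t+T}z_{t+T}$. Let $\beta(\xi)=J(0,\xi,\tilde u)-J(0,\xi,\tilde u^*)$ for the input $\tilde u$ that it generates from $\tilde x_0=\xi$; both costs are finite. **Constants.** With $\hat X_{t+1}=\mathcal R_{t+1}\circ\cdots\circ\mathcal R_{t+T-1}(X_{t+T})$ and $K_t=(\tilde R_t+\tilde B_t'\hat X_{t+1}\tilde B_t)^{-1}\tilde B_t'\hat X_{t+1}\tilde A_t$, let $$\overline\omega=\sup_t\|\mathcal R_t(\hat X_{t+1})\|_2,\quad \underline\omega=\inf_t\lambda_{\min}(\mathcal R_t(\hat X_{t+1})),\quad \underline\lambda=\inf_t\lambda_{\min}(\tilde Q_t+K_t'\tilde R_tK_t),\quad \overline\lambda=\sup_t\|P_t\|_2,$$ $$\overline\delta=\sqrt n\,\log\Big(\sup_t\frac{\|X_{t+T}\|_2}{\lambda_{\min}(P_{t+T})}\Big),\quad \overline\zeta=\sup_t\big\|(\tilde Q_t+\tilde Q_t\tilde A_t^{-1}\tilde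 B_t\tilde R_t^{-1}\tilde B_t'(\tilde A_t')^{-1}\tilde Q_t)^{-1}\big\|_2,$$ $$\underline\epsilon=\inf_t\lambda_{\min}\big(\tilde A_t^{-1}\tilde B_t(\tilde R_t+\tilde B_t'(\tilde A_t')^{-1}\tilde Q_t\tilde A_t^{-1}\tilde B_t)^{-1}\tilde B_t'(\tilde A_t')^{-1}\big),$$ all over $t\in\mathbb N_0$. **Claim.** All seven constants are finite and positive, and for every $\overline\beta>0$ the following holds: if $$T\ \ge\ \frac{\log\Big(\log\Big(\Big(\dfrac{\overline\beta\,\underline\lambda\,\underline\omega}{\overline\omega\,\overline\lambda\,\overline\omega}+1\Big)^{1/\overline\delta}\Big)\Big)}{\log\Big(\dfrac{\overline\zeta}{\overline\zeta+\underline\epsilon}\Big)}+1,$$ then $\beta(\xi)\le\overline\beta\,|\xi|^2$ for all $\xi\in\mathbb R^n$. -/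

import Mathlib

open scoped Matrix

/-! ### Matrix notions -/

namespace LQR

section SquareRoot
open scoped MatrixOrder

/-- The positive semidefinite square root `M^{1/2}` of a positive semidefinite matrix. -/
noncomputable def psdSqrt {n : ℕ} (M : Matrix (Fin n) (Fin n) ℝ) : Matrix (Fin n) (Fin n) ℝ :=
  CFC.sqrt M

end SquareRoot

section Norm
open scoped Matrix.Norms.L2Operator

/-- The induced Euclidean norm `‖M‖₂ = max_{|x| = 1} |M x|`. -/
noncomputable def norm2 {p q : ℕ} (M : Matrix (Fin p) (Fin q) ℝ) : ℝ := ‖M‖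

end Norm

/-- `λ_min(M) = min_{|x| = 1} x' M x`. -/
noncomputable def lambdaMin {n : ℕ} (M : Matrix (Fin n) (Fin n) ℝ) : ℝ :=
  ⨅ x : {x : Fin n → ℝ // x ⬝ᵥ x = 1}, x.1 ⬝ᵥ (M *ᵥ x.1)

end LQR

/-- Problem data `(A_k, B_k, Q_k, R_k)`, `k = 0, 1, 2, …`, with state dimension `n` and input
dimension `m`. -/
structure LQRData (n m : ℕ) where
  A : ℕ → Matrix (Fin n) (Fin n) ℝ
  B : ℕ → Matrix (Fin n) (Fin m) ℝ
  Q : ℕ → Matrix (Fin n) (Fin n) ℝ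
  R : ℕ → Matrix (Fin m) (Fin m) ℝ

namespace LQRData

open LQR

variable {n m : ℕ} (S : LQRData n m)

/-- `C_k = Q_k^{1/2}`. -/
noncomputable def C (k : ℕ) : Matrix (Fin n) (Fin n) ℝ := psdSqrt (S.Q k)

/-- The state transition matrix `Θ_{k,j} = A_{k+j-1} ⋯ A_k`. -/
def Theta (k : ℕ) : ℕ → Matrix (Fin n) (Fin n) ℝ
  | 0 => 1
  | j + 1 => S.A (k + j) * Theta k j

/-- The `d`-step controllability matrix: its `j`-th block is `Θ_{k+j+1,d-1-j} B_{k+j}`,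
`j = 0, …, d-1`. -/
def ctrMatrix (k d : ℕ) : Matrix (Fin n) (Fin d × Fin m) ℝ :=
  Matrix.of fun a p => (S.Theta (k + p.1 + 1) (d - 1 - p.1) * S.B (k + p.1)) a p.2

/-- The `d`-step observability matrix: its `i`-th block is `C_{k+i} Θ_{k,i}`, `i = 0, …, d`. -/
noncomputable def obsMatrix (k d : ℕ) : Matrix (Fin (d + 1) × Fin n) (Fin n) ℝ :=
  Matrix.of fun p b => (S.C (k + p.1) * S.Theta k p.1) p.2 b

/-! ### Lifted problem data (`d` is the lifting length, `t` the lifted time) -/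

variable (d : ℕ)

/-- The matrix `Â_t`: identity minus the block matrix with `A_{dt}, …, A_{d(t+1)-1}` on the first
block subdiagonal. -/
def hatA (t : ℕ) : Matrix (Fin (d + 1) × Fin n) (Fin (d + 1) × Fin n) ℝ :=
  1 - Matrix.of fun p q => if (p.1 : ℕ) = q.1 + 1 then S.A (d * t + q.1) p.2 q.2 else 0

/-- The matrix `B̂_t`: a zero block row on top of `diag(B_{dt}, …, B_{d(t+1)-1})`. -/
def hatB (t : ℕ) : Matrix (Fin (d + 1) × Fin n) (Fin d × Fin m) ℝ :=
  Matrix.of fun p q => if (p.1 : ℕ) = q.1 + 1 then S.B (d * t + q.1) p.2 q.2 else 0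

/-- The matrix `Ĉ_t`: `diag(C_{dt}, …, C_{d(t+1)-1})` followed by a zero block column. -/
noncomputable def hatC (t : ℕ) : Matrix (Fin d × Fin n) (Fin (d + 1) × Fin n) ℝ :=
  Matrix.of fun p q => if (p.1 : ℕ) = q.1 then S.C (d * t + p.1) p.2 q.2 else 0

/-- The block row `[0 I_n]`. -/
def lastBlock (n d : ℕ) : Matrix (Fin n) (Fin (d + 1) × Fin n) ℝ :=
  Matrix.of fun a p => if p.1 = Fin.last d ∧ p.2 = a then 1 else 0

/-- The block column with `I_n` on top of zero. -/
def firstBlock (n d : ℕ) : Matrix (Fin (d + 1) × Fin n) (Fin n) ℝ :=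
  Matrix.of fun p a => if p.1 = 0 ∧ p.2 = a then 1 else 0

/-- `diag(R_{dt}, …, R_{dt+d-1})`. -/
def diagR (t : ℕ) : Matrix (Fin d × Fin m) (Fin d × Fin m) ℝ :=
  Matrix.of fun p q => if p.1 = q.1 then S.R (d * t + p.1) p.2 q.2 else 0

noncomputable def Phi (t : ℕ) : Matrix (Fin n) (Fin n) ℝ :=
  lastBlock n d * (S.hatA d t)⁻¹ * firstBlock n d

noncomputable def Gam (t : ℕ) : Matrix (Fin n) (Fin d × Fin m) ℝ :=
  lastBlock n d * (S.hatA d t)⁻¹ * S.hatB d t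

noncomputable def Xi (t : ℕ) : Matrix (Fin d × Fin n) (Fin n) ℝ :=
  S.hatC d t * (S.hatA d t)⁻¹ * firstBlock n d

noncomputable def Del (t : ℕ) : Matrix (Fin d × Fin n) (Fin d × Fin m) ℝ :=
  S.hatC d t * (S.hatA d t)⁻¹ * S.hatB d t

noncomputable def Rt (t : ℕ) : Matrix (Fin d × Fin m) (Fin d × Fin m) ℝ :=
  S.diagR d t + (S.Del d t)ᵀ * S.Del d t

noncomputable def Qt (t : ℕ) : Matrix (Fin n) (Fin n) ℝ :=
  (S.Xi d t)ᵀ * S.Xi d t - (S.Xi d t)ᵀ * S.Del d t * (S.Rt d t)⁻¹ * (S.Del d t)ᵀ * S.Xi d t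

noncomputable def At (t : ℕ) : Matrix (Fin n) (Fin n) ℝ :=
  S.Phi d t - S.Gam d t * (S.Rt d t)⁻¹ * (S.Del d t)ᵀ * S.Xi d t

noncomputable def Bt (t : ℕ) : Matrix (Fin n) (Fin d × Fin m) ℝ := S.Gam d t

/-! ### Cost, trajectories and policies for the lifted problem -/

/-- The trajectory from state `χ` at time `t` under `w`: `traj t χ w i` is `z_{t+i}`, and `w i` is
the input applied at time `t + i`. -/
noncomputable def traj (t : ℕ) (χ : Fin n → ℝ) (w : ℕ → Fin d × Fin m → ℝ) : ℕ → Fin n → ℝ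
  | 0 => χ
  | i + 1 => S.At d (t + i) *ᵥ traj t χ w i + S.Bt d (t + i) *ᵥ w i

/-- The finite-horizon cost `J_T(t, χ, w) = ∑_{j=t}^{t+T-1} z_j' Q̃_j z_j + w_j' R̃_j w_j`; here
`w i` is the input applied at time `t + i`, so that only `w 0, …, w (T-1)` matter. -/
noncomputable def costJ (T t : ℕ) (χ : Fin n → ℝ) (w : ℕ → Fin d × Fin m → ℝ) : ℝ :=
  ∑ i ∈ Finset.range T,
    (S.traj d t χ w i ⬝ᵥ (S.Qt d (t + i) *ᵥ S.traj d t χ w i) +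
      w i ⬝ᵥ (S.Rt d (t + i) *ᵥ w i))

/-- A finite input sequence, extended by zero. -/
def pad {d m T : ℕ} (w : Fin T → Fin d × Fin m → ℝ) : ℕ → Fin d × Fin m → ℝ :=
  fun i => if h : i < T then w ⟨i, h⟩ else 0

/-- `L_T(t, χ, w, X) = J_T(t, χ, w) + z_{t+T}' X z_{t+T}`. -/
noncomputable def costL (T t : ℕ) (χ : Fin n → ℝ) (w : Fin T → Fin d × Fin m → ℝ)
    (X : Matrix (Fin n) (Fin n) ℝ) : ℝ :=
  S.costJ d T t χ (pad w) + S.traj d t χ (pad w) T ⬝ᵥ (X *ᵥ S.traj d t χ (pad w) T)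

/-- The infinite-horizon cost `J(0, ξ, u) = lim_{T → ∞} J_T(0, ξ, u_{[0:T-1]})` exists as a real
number and equals `c`. -/
def HasCost (ξ : Fin n → ℝ) (u : ℕ → Fin d × Fin m → ℝ) (c : ℝ) : Prop :=
  Filter.Tendsto (fun T => S.costJ d T 0 ξ u) Filter.atTop (nhds c)

/-- The Riccati operator at lifted time `t`. -/
noncomputable def ricc (t : ℕ) (P : Matrix (Fin n) (Fin n) ℝ) : Matrix (Fin n) (Fin n) ℝ :=
  S.Qt d t + (S.At d t)ᵀ *
    (P - P * S.Bt d t * (S.Rt d t + (S.Bt d t)ᵀ * P * S.Bt d t)⁻¹ * (S.Bt d t)ᵀ * P) * S.At d t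

/-- The composition of `k` Riccati operators applied to `X`, the outermost one at time `t` and the
innermost one at time `t + k - 1`. -/
noncomputable def riccComp : ℕ → ℕ → Matrix (Fin n) (Fin n) ℝ → Matrix (Fin n) (Fin n) ℝ
  | _, 0, X => X
  | t, k + 1, X => S.ricc d t (riccComp (t + 1) k X)

/-- `P` is a bounded positive semidefinite solution of the backward Riccati recursion. -/
def IsBoundedRiccatiSolution (P : ℕ → Matrix (Fin n) (Fin n) ℝ) : Prop :=
  (∀ t, (P t).PosSemidef) ∧ (∃ M : ℝ, ∀ t, norm2 (P t) ≤ M) ∧ ∀ t, P t = S.ricc d t (P (t + 1))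

/-- The linear feedback gain `(R̃_t + B̃_t' X B̃_t)⁻¹ B̃_t' X Ã_t`. -/
noncomputable def gain (t : ℕ) (X : Matrix (Fin n) (Fin n) ℝ) : Matrix (Fin d × Fin m) (Fin n) ℝ :=
  (S.Rt d t + (S.Bt d t)ᵀ * X * S.Bt d t)⁻¹ * (S.Bt d t)ᵀ * X * S.At d t

/-- The optimal policy `μ*` associated with the Riccati solution `P`. -/
noncomputable def optPolicy (P : ℕ → Matrix (Fin n) (Fin n) ℝ) :
    ℕ → (Fin n → ℝ) → Fin d × Fin m → ℝ :=
  fun t x => -(S.gain d t (P (t + 1)) *ᵥ x)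

/-- The terminal penalty matrix with index `j`. -/
noncomputable def termX (j : ℕ) : Matrix (Fin n) (Fin n) ℝ :=
  S.Qt d j + (S.At d j)ᵀ * (S.Bt d j * (S.Bt d j)ᵀ)⁻¹ * S.Bt d j * S.Rt d j *
    (S.Bt d j)ᵀ * (S.Bt d j * (S.Bt d j)ᵀ)⁻¹ * S.At d j

/-- `μ` is the `T`-step receding-horizon policy with terminal penalties `X_{t+T}`: `μ t χ` is the
first entry of a minimizer of `L_T(t, χ, ·, X_{t+T})`. -/
def IsRecedingHorizonPolicy (T : ℕ) (μ : ℕ → (Fin n → ℝ) → Fin d × Fin m → ℝ) : Prop :=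
  ∀ t χ, ∃ w : Fin T → Fin d × Fin m → ℝ,
    (∀ w', S.costL d T t χ w (S.termX d (t + T)) ≤ S.costL d T t χ w' (S.termX d (t + T))) ∧
      μ t χ = pad w 0

/-- The closed-loop state trajectory under the policy `μ` from the initial state `ξ`. -/
noncomputable def clState (μ : ℕ → (Fin n → ℝ) → Fin d × Fin m → ℝ) (ξ : Fin n → ℝ) :
    ℕ → Fin n → ℝ
  | 0 => ξ
  | t + 1 => S.At d t *ᵥ clState μ ξ t + S.Bt d t *ᵥ μ t (clState μ ξ t)

/-- The input sequence generated in closed loop by the policy `μ` from the initial state `ξ`. -/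
noncomputable def clInput (μ : ℕ → (Fin n → ℝ) → Fin d × Fin m → ℝ) (ξ : Fin n → ℝ) :
    ℕ → Fin d × Fin m → ℝ :=
  fun t => μ t (S.clState d μ ξ t)

/-! ### Constants (`T` is the prediction horizon, `T ≥ 1`) -/

/-- `hatXsucc T t` is `X̂_{t+1}`, the composition of the Riccati operators at times `t + 1` up to
`t + T - 1`, applied to `X_{t+T}`. -/
noncomputable def hatXsucc (T t : ℕ) : Matrix (Fin n) (Fin n) ℝ :=
  S.riccComp d (t + 1) (T - 1) (S.termX d (t + T))

/-- `‖ℛ_t(X̂_{t+1})‖₂`. -/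
noncomputable def omegaUpAt (T t : ℕ) : ℝ := norm2 (S.ricc d t (S.hatXsucc d T t))

noncomputable def omegaUp (T : ℕ) : ℝ := ⨆ t, S.omegaUpAt d T t

noncomputable def omegaLow (T : ℕ) : ℝ := ⨅ t, lambdaMin (S.ricc d t (S.hatXsucc d T t))

noncomputable def lambdaLow (T : ℕ) : ℝ :=
  ⨅ t, lambdaMin (S.Qt d t +
    (S.gain d t (S.hatXsucc d T t))ᵀ * S.Rt d t * S.gain d t (S.hatXsucc d T t))

/-- `‖X_{t+T}‖₂ / λ_min(P_{t+T})`. -/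
noncomputable def deltaRatioAt (P : ℕ → Matrix (Fin n) (Fin n) ℝ) (T t : ℕ) : ℝ :=
  norm2 (S.termX d (t + T)) / lambdaMin (P (t + T))

noncomputable def deltaUp (P : ℕ → Matrix (Fin n) (Fin n) ℝ) (T : ℕ) : ℝ :=
  √(n : ℝ) * Real.log (⨆ t, S.deltaRatioAt d P T t)

/-- `ζ_t`. -/
noncomputable def zetaAt (t : ℕ) : ℝ :=
  norm2 ((S.Qt d t + S.Qt d t * (S.At d t)⁻¹ * S.Bt d t * (S.Rt d t)⁻¹ * (S.Bt d t)ᵀ *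
    ((S.At d t)ᵀ)⁻¹ * S.Qt d t)⁻¹)

noncomputable def zetaUp : ℝ := ⨆ t, S.zetaAt d t

/-- `ε_t`. -/
noncomputable def epsAt (t : ℕ) : ℝ :=
  lambdaMin ((S.At d t)⁻¹ * S.Bt d t *
    (S.Rt d t + (S.Bt d t)ᵀ * ((S.At d t)ᵀ)⁻¹ * S.Qt d t * (S.At d t)⁻¹ * S.Bt d t)⁻¹ *
    (S.Bt d t)ᵀ * ((S.At d t)ᵀ)⁻¹)

noncomputable def epsLow : ℝ := ⨅ t, S.epsAt d t

end LQRData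

/-- `λ̄ = sup_t ‖P_t‖₂`. -/
noncomputable def LQR.lambdaUp {n : ℕ} (P : ℕ → Matrix (Fin n) (Fin n) ℝ) : ℝ :=
  ⨆ t, LQR.norm2 (P t)

/-!
# Performance loss of receding-horizon control

**Idea.** For a fixed feedback, the loss of optimality is governed by the ratio of the value
function `X̂_{t+1}` used by the receding-horizon policy to the optimal value function `P_{t+1}`. If
`X̂_{t+1} ≤ c P_{t+1}` in the Loewner order, then applying the receding-horizon input for one stage
costs at most a factor `c` more than optimal, so that the loss is at most
`(c - 1) ∑ x_t' P_t x_t`. The sum is finite because the receding-horizon value functions decrease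
along the closed loop (`IsUniform.ricc_hatXsucc_le`): the terminal penalty `X_j` is the cost of the
deadbeat feedback, hence an upper bound of every Riccati image. This is
`IsUniform.recedingHorizon_loss_le`.

**The ratio.** The Riccati operator contracts the logarithm of the ratio by `ρ = ζ / (ζ + ε)`
(`LQR.riccMap_contraction`). Writing `W` for the matrix whose inverse defines `ζ` and `E` for the
matrix that defines `ε`, one has `E = Q⁻¹ - W⁻¹` and
`ℛ(P)⁻¹ = Q⁻¹ - (W + Q A⁻¹ P⁻¹ A'⁻¹ Q)⁻¹`. By convexity of the inverse, the last expression is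
concave along the segment from `P⁻¹` to `0`, where it takes the value `E`; comparing `E` with
`ℛ(P)⁻¹ ≤ E + W⁻¹` gives the rate. After `T - 1` steps a ratio `α` has become `α ^ ρ ^ (T - 1)`, and
the condition on `T` says that this is small enough. The same contraction yields uniqueness of the
bounded solution of the Riccati recursion; existence is a monotone limit.

**Boundedness.** The theory above needs the lifted data to be bounded, which is not evident for
`Ã_t`, as `R_k` may approach singularity. However, `det Ã_t · det R̃_t = det Φ_t · det R`
(`abs_det_At_le`), because `Δ' (Δ - Ξ Φ⁻¹ Γ)` is strictly block triangular; so `det Ã_t` is bounded,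
`Ã_t⁻¹` is bounded by assumption, and `Ã_t = det Ã_t · adj (Ã_t⁻¹)` is bounded as well.
-/

/-! ### Quadratic forms -/

namespace LQR

variable {ι κ : Type*} [Fintype ι] [Fintype κ]

/-- The value `x' M x` of the quadratic form with matrix `M`. -/
def quadForm (M : Matrix ι ι ℝ) (x : ι → ℝ) : ℝ := x ⬝ᵥ (M *ᵥ x)

theorem quadForm_add (M N : Matrix ι ι ℝ) (x : ι → ℝ) :
    quadForm (M + N) x = quadForm M x + quadForm N x := by
  simp [quadForm, Matrix.add_mulVec, dotProduct_add]

theorem quadForm_sub (M N : Matrix ι ι ℝ) (x : ι → ℝ) :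
    quadForm (M - N) x = quadForm M x - quadForm N x := by
  simp [quadForm, Matrix.sub_mulVec, dotProduct_sub]

theorem quadForm_smul (c : ℝ) (M : Matrix ι ι ℝ) (x : ι → ℝ) :
    quadForm (c • M) x = c * quadForm M x := by
  simp [quadForm, Matrix.smul_mulVec, dotProduct_smul]

theorem quadForm_smul_vec (M : Matrix ι ι ℝ) (c : ℝ) (x : ι → ℝ) :
    quadForm M (c • x) = c ^ 2 * quadForm M x := by
  simp [quadForm, Matrix.mulVec_smul, dotProduct_smul, smul_dotProduct]
  ring

theorem quadForm_neg_vec (M : Matrix ι ι ℝ) (x : ι → ℝ) : quadForm M (-x) = quadForm M x := by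
  simp [quadForm, Matrix.mulVec_neg]

theorem quadForm_zero_vec (M : Matrix ι ι ℝ) : quadForm M 0 = 0 := by
  simp [quadForm]

theorem quadForm_one [DecidableEq ι] (x : ι → ℝ) : quadForm 1 x = x ⬝ᵥ x := by
  simp [quadForm]

theorem dotProduct_mulVec_transpose (V : Matrix ι κ ℝ) (x : κ → ℝ) (y : ι → ℝ) :
    x ⬝ᵥ (Vᵀ *ᵥ y) = (V *ᵥ x) ⬝ᵥ y := by
  rw [Matrix.mulVec_transpose, dotProduct_comm, Matrix.dotProduct_mulVec y V x |>.symm,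
    dotProduct_comm]

theorem quadForm_transpose_mul_mul (V : Matrix ι κ ℝ) (M : Matrix ι ι ℝ) (x : κ → ℝ) :
    quadForm (Vᵀ * M * V) x = quadForm M (V *ᵥ x) := by
  simp only [quadForm, ← Matrix.mulVec_mulVec]
  rw [dotProduct_mulVec_transpose]

theorem quadForm_transpose_mul_self (V : Matrix ι κ ℝ) (x : κ → ℝ) :
    quadForm (Vᵀ * V) x = (V *ᵥ x) ⬝ᵥ (V *ᵥ x) := by
  simp only [quadForm, ← Matrix.mulVec_mulVec]
  rw [dotProduct_mulVec_transpose]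

theorem quadForm_mul_transpose_self (V : Matrix ι κ ℝ) (x : ι → ℝ) :
    quadForm (V * Vᵀ) x = (Vᵀ *ᵥ x) ⬝ᵥ (Vᵀ *ᵥ x) := by
  simpa using quadForm_transpose_mul_self Vᵀ x

theorem dotProduct_mulVec_symm {M : Matrix ι ι ℝ} (hM : Mᵀ = M) (x y : ι → ℝ) :
    x ⬝ᵥ (M *ᵥ y) = y ⬝ᵥ (M *ᵥ x) := by
  conv_lhs => rw [← hM]
  rw [dotProduct_mulVec_transpose, dotProduct_comm]

theorem quadForm_add_vec {M : Matrix ι ι ℝ} (hM : Mᵀ = M) (x y : ι → ℝ) :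
    quadForm M (x + y) = quadForm M x + 2 * (x ⬝ᵥ (M *ᵥ y)) + quadForm M y := by
  simp only [quadForm, Matrix.mulVec_add, dotProduct_add, add_dotProduct]
  rw [dotProduct_mulVec_symm hM y x]
  ring

theorem quadForm_sub_vec {M : Matrix ι ι ℝ} (hM : Mᵀ = M) (x y : ι → ℝ) :
    quadForm M (x - y) = quadForm M x - 2 * (x ⬝ᵥ (M *ᵥ y)) + quadForm M y := by
  rw [sub_eq_add_neg, quadForm_add_vec hM, quadForm_neg_vec, Matrix.mulVec_neg, dotProduct_neg]
  ring

theorem posSemidef_iff {M : Matrix ι ι ℝ} :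
    M.PosSemidef ↔ Mᵀ = M ∧ ∀ x, 0 ≤ quadForm M x := by
  rw [Matrix.posSemidef_iff_dotProduct_mulVec, Matrix.IsHermitian,
    Matrix.conjTranspose_eq_transpose_of_trivial]
  rfl

theorem posDef_iff {M : Matrix ι ι ℝ} :
    M.PosDef ↔ Mᵀ = M ∧ ∀ x, x ≠ 0 → 0 < quadForm M x := by
  rw [Matrix.posDef_iff_dotProduct_mulVec, Matrix.IsHermitian,
    Matrix.conjTranspose_eq_transpose_of_trivial]
  rfl

theorem dotProduct_self_nonneg' (x : ι → ℝ) : 0 ≤ x ⬝ᵥ x :=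
  Finset.sum_nonneg fun i _ => mul_self_nonneg (x i)

theorem dotProduct_self_pos {x : ι → ℝ} (hx : x ≠ 0) : 0 < x ⬝ᵥ x :=
  lt_of_le_of_ne (dotProduct_self_nonneg' x) fun h => hx (dotProduct_self_eq_zero.1 h.symm)

theorem dotProduct_sq_le (x y : ι → ℝ) : (x ⬝ᵥ y) ^ 2 ≤ (x ⬝ᵥ x) * (y ⬝ᵥ y) := by
  have := Finset.sum_mul_sq_le_sq_mul_sq Finset.univ x y
  simpa [dotProduct, sq] using this

theorem posDef_of_lower_bound {M : Matrix ι ι ℝ} (hM : Mᵀ = M) {q : ℝ} (hq : 0 < q)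
    (h : ∀ x, q * (x ⬝ᵥ x) ≤ quadForm M x) : M.PosDef :=
  posDef_iff.2 ⟨hM, fun x hx => lt_of_lt_of_le (mul_pos hq (dotProduct_self_pos hx)) (h x)⟩

section Inverse

variable [DecidableEq ι]

theorem mul_inv_of_posDef {N : Matrix ι ι ℝ} (hN : N.PosDef) : N * N⁻¹ = 1 :=
  Matrix.mul_nonsing_inv _ ((Matrix.isUnit_iff_isUnit_det _).1 hN.isUnit)

theorem inv_mul_of_posDef {N : Matrix ι ι ℝ} (hN : N.PosDef) : N⁻¹ * N = 1 :=
  Matrix.nonsing_inv_mul _ ((Matrix.isUnit_iff_isUnit_det _).1 hN.isUnit)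

theorem transpose_inv_of_symm {N : Matrix ι ι ℝ} (hN : Nᵀ = N) : N⁻¹ᵀ = N⁻¹ := by
  rw [Matrix.transpose_nonsing_inv, hN]

theorem mulVec_inv_mulVec {N : Matrix ι ι ℝ} (hN : N.PosDef) (x : ι → ℝ) :
    N *ᵥ (N⁻¹ *ᵥ x) = x := by
  rw [Matrix.mulVec_mulVec, mul_inv_of_posDef hN, Matrix.one_mulVec]

/-- With `le_quadForm_inv` this is the variational formula
`x' N⁻¹ x = max_y (2 x' y - y' N y)`. -/
theorem quadForm_inv_eq {N : Matrix ι ι ℝ} (hN : N.PosDef) (x : ι → ℝ) :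
    quadForm N⁻¹ x = 2 * (x ⬝ᵥ (N⁻¹ *ᵥ x)) - quadForm N (N⁻¹ *ᵥ x) := by
  have : quadForm N (N⁻¹ *ᵥ x) = x ⬝ᵥ (N⁻¹ *ᵥ x) := by
    rw [quadForm, mulVec_inv_mulVec hN, dotProduct_comm]
  rw [this, quadForm]
  ring

theorem le_quadForm_inv {N : Matrix ι ι ℝ} (hN : N.PosDef) (x y : ι → ℝ) :
    2 * (x ⬝ᵥ y) - quadForm N y ≤ quadForm N⁻¹ x := by
  have h := (posSemidef_iff.1 hN.posSemidef).2 (y - N⁻¹ *ᵥ x)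
  have hs := (posDef_iff.1 hN).1
  rw [quadForm_sub_vec hs, mulVec_inv_mulVec hN, dotProduct_comm y x] at h
  have := quadForm_inv_eq hN x
  have h2 : quadForm N⁻¹ x = x ⬝ᵥ (N⁻¹ *ᵥ x) := rfl
  linarith

theorem quadForm_inv_le {N : Matrix ι ι ℝ} (hN : N.PosDef) {q : ℝ} (hq : 0 < q)
    (h : ∀ x, q * (x ⬝ᵥ x) ≤ quadForm N x) (x : ι → ℝ) :
    quadForm N⁻¹ x ≤ q⁻¹ * (x ⬝ᵥ x) := by
  rw [quadForm_inv_eq hN]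
  set y := N⁻¹ *ᵥ x
  have h1 := h y
  have h2 := dotProduct_self_nonneg' (x - q • y)
  simp only [sub_dotProduct, dotProduct_sub, dotProduct_smul, smul_dotProduct, smul_eq_mul,
    dotProduct_comm y x] at h2
  have h3 : 0 ≤ q⁻¹ * (x ⬝ᵥ x - q * x ⬝ᵥ y - q * (x ⬝ᵥ y - q * y ⬝ᵥ y)) :=
    mul_nonneg (inv_nonneg.2 hq.le) (by linarith)
  have h4 : q⁻¹ * (x ⬝ᵥ x - q * x ⬝ᵥ y - q * (x ⬝ᵥ y - q * y ⬝ᵥ y)) =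
      q⁻¹ * (x ⬝ᵥ x) - 2 * (x ⬝ᵥ y) + q * (y ⬝ᵥ y) := by
    field_simp
    ring
  linarith

theorem le_quadForm_inv_of_le {N : Matrix ι ι ℝ} (hN : N.PosDef) {c : ℝ} (hc : 0 < c)
    (h : ∀ x, quadForm N x ≤ c * (x ⬝ᵥ x)) (x : ι → ℝ) :
    c⁻¹ * (x ⬝ᵥ x) ≤ quadForm N⁻¹ x := by
  refine le_trans ?_ (le_quadForm_inv hN x (c⁻¹ • x))
  have h1 := h (c⁻¹ • x)
  simp only [dotProduct_smul, smul_dotProduct, smul_eq_mul] at h1 ⊢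
  have : c * (c⁻¹ * (c⁻¹ * x ⬝ᵥ x)) = c⁻¹ * x ⬝ᵥ x := by field_simp
  linarith

/-- Inversion reverses the order of positive definite matrices. -/
theorem quadForm_le_of_inv_le {M N : Matrix ι ι ℝ} (hM : M.PosDef) (hN : N.PosDef)
    (h : ∀ y, quadForm N⁻¹ y ≤ quadForm M⁻¹ y) (x : ι → ℝ) : quadForm M x ≤ quadForm N x := by
  have hM' : M⁻¹⁻¹ = M := Matrix.nonsing_inv_nonsing_inv _
    ((Matrix.isUnit_iff_isUnit_det _).1 hM.isUnit)
  have hN' : N⁻¹⁻¹ = N := Matrix.nonsing_inv_nonsing_inv _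
    ((Matrix.isUnit_iff_isUnit_det _).1 hN.isUnit)
  have h1 := quadForm_inv_eq hM.inv x
  have h2 := le_quadForm_inv hN.inv x (M⁻¹⁻¹ *ᵥ x)
  rw [hN'] at h2
  nth_rewrite 1 [hM'] at h1
  have := h (M⁻¹⁻¹ *ᵥ x)
  linarith

/-- The inverse is a convex function on positive definite matrices. -/
theorem quadForm_inv_convex {M N F : Matrix ι ι ℝ} (hM : M.PosDef) (hN : N.PosDef)
    (hF : F.PosDef) {s : ℝ} (hs0 : 0 ≤ s) (hs1 : s ≤ 1)
    (h : F = (1 - s) • M + s • N) (x : ι → ℝ) :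
    quadForm F⁻¹ x ≤ (1 - s) * quadForm M⁻¹ x + s * quadForm N⁻¹ x := by
  rw [quadForm_inv_eq hF]
  set y := F⁻¹ *ᵥ x
  have h1 := mul_le_mul_of_nonneg_left (le_quadForm_inv hM x y) (sub_nonneg.2 hs1)
  have h2 := mul_le_mul_of_nonneg_left (le_quadForm_inv hN x y) hs0
  rw [h, quadForm_add, quadForm_smul, quadForm_smul]
  nlinarith

end Inverse

/-! ### Spectral norm and smallest eigenvalue -/

theorem norm2_nonneg {p q : ℕ} (M : Matrix (Fin p) (Fin q) ℝ) : 0 ≤ norm2 M := by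
  open scoped Matrix.Norms.L2Operator in
  exact norm_nonneg M

theorem norm_toLp_sq (x : ι → ℝ) : ‖(WithLp.toLp 2 x : EuclideanSpace ℝ ι)‖ ^ 2 = x ⬝ᵥ x := by
  rw [EuclideanSpace.norm_sq_eq]
  simp [dotProduct, sq]

theorem mulVec_dotProduct_self_le {p q : ℕ} (M : Matrix (Fin p) (Fin q) ℝ) (x : Fin q → ℝ) :
    (M *ᵥ x) ⬝ᵥ (M *ᵥ x) ≤ norm2 M ^ 2 * (x ⬝ᵥ x) := by
  have h := open scoped Matrix.Norms.L2Operator in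
    Matrix.l2_opNorm_mulVec (𝕜 := ℝ) M (WithLp.toLp 2 x)
  rw [← norm_toLp_sq, ← norm_toLp_sq, ← mul_pow]
  exact pow_le_pow_left₀ (norm_nonneg _) h 2

theorem norm2_le {p q : ℕ} {M : Matrix (Fin p) (Fin q) ℝ} {c : ℝ} (hc : 0 ≤ c)
    (h : ∀ x, (M *ᵥ x) ⬝ᵥ (M *ᵥ x) ≤ c ^ 2 * (x ⬝ᵥ x)) : norm2 M ≤ c := by
  unfold norm2
  rw [Matrix.l2_opNorm_def]
  refine ContinuousLinearMap.opNorm_le_bound _ hc fun x => ?_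
  refine le_of_sq_le_sq ?_ (by positivity)
  have := h x.ofLp
  rw [← norm_toLp_sq, ← norm_toLp_sq, ← mul_pow] at this
  exact this

theorem quadForm_le_norm2 {p : ℕ} (M : Matrix (Fin p) (Fin p) ℝ) (x : Fin p → ℝ) :
    quadForm M x ≤ norm2 M * (x ⬝ᵥ x) := by
  refine le_of_sq_le_sq ?_ (mul_nonneg (norm2_nonneg M) (dotProduct_self_nonneg' x))
  calc quadForm M x ^ 2 ≤ (x ⬝ᵥ x) * ((M *ᵥ x) ⬝ᵥ (M *ᵥ x)) := dotProduct_sq_le _ _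
    _ ≤ (x ⬝ᵥ x) * (norm2 M ^ 2 * (x ⬝ᵥ x)) :=
        mul_le_mul_of_nonneg_left (mulVec_dotProduct_self_le M x) (dotProduct_self_nonneg' x)
    _ = _ := by ring

theorem abs_le_norm2 {p q : ℕ} (M : Matrix (Fin p) (Fin q) ℝ) (i : Fin p) (j : Fin q) :
    |M i j| ≤ norm2 M := by
  have h := mulVec_dotProduct_self_le M (Pi.single j 1)
  simp only [Matrix.mulVec_single_one, dotProduct_single_one, Pi.single_eq_same, mul_one] at h
  refine abs_le_of_sq_le_sq ?_ (norm2_nonneg M)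
  refine le_trans ?_ h
  have := Finset.single_le_sum (f := fun i => M.col j i * M.col j i)
    (fun i _ => mul_self_nonneg _) (Finset.mem_univ i)
  simpa [dotProduct, sq] using this

/-- Positivity of `λ_min` makes it a genuine lower bound, because the infimum of a set that is not
bounded below is `0` by convention. -/
theorem lambdaMin_mul_le {p : ℕ} {M : Matrix (Fin p) (Fin p) ℝ} (h : 0 < lambdaMin M)
    (x : Fin p → ℝ) : lambdaMin M * (x ⬝ᵥ x) ≤ quadForm M x := by
  by_cases hx : x = 0
  · simp [hx, quadForm]
  have hp := dotProduct_self_pos hx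
  have hb : BddBelow (Set.range fun x : {x : Fin p → ℝ // x ⬝ᵥ x = 1} => x.1 ⬝ᵥ (M *ᵥ x.1)) := by
    by_contra hb
    exact h.ne' (Real.iInf_of_not_bddBelow hb)
  have hs : (√(x ⬝ᵥ x))⁻¹ ^ 2 = (x ⬝ᵥ x)⁻¹ := by rw [inv_pow, Real.sq_sqrt hp.le]
  have h1 : ((√(x ⬝ᵥ x))⁻¹ • x) ⬝ᵥ ((√(x ⬝ᵥ x))⁻¹ • x) = 1 := by
    rw [smul_dotProduct, dotProduct_smul, smul_smul, ← sq, hs, smul_eq_mul, inv_mul_cancel₀ hp.ne']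
  have h2 : lambdaMin M ≤ quadForm M ((√(x ⬝ᵥ x))⁻¹ • x) := ciInf_le hb ⟨_, h1⟩
  rw [quadForm_smul_vec, hs, inv_mul_eq_div, le_div_iff₀ hp] at h2
  exact h2

theorem le_lambdaMin {p : ℕ} (hp : 0 < p) {M : Matrix (Fin p) (Fin p) ℝ} {c : ℝ}
    (h : ∀ x, c * (x ⬝ᵥ x) ≤ quadForm M x) : c ≤ lambdaMin M := by
  have : Nonempty {x : Fin p → ℝ // x ⬝ᵥ x = 1} :=
    ⟨⟨Pi.single ⟨0, hp⟩ 1, by simp⟩⟩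
  refine le_ciInf fun x => ?_
  have := h x.1
  rw [x.2, mul_one] at this
  exact this

theorem lambdaMin_of_iInf_pos {p : ℕ} {M : ℕ → Matrix (Fin p) (Fin p) ℝ}
    (h : 0 < ⨅ t, lambdaMin (M t)) (t : ℕ) (x : Fin p → ℝ) :
    (⨅ t, lambdaMin (M t)) * (x ⬝ᵥ x) ≤ quadForm (M t) x := by
  have hb : BddBelow (Set.range fun t => lambdaMin (M t)) := by
    by_contra hb
    exact h.ne' (Real.iInf_of_not_bddBelow hb)
  have h1 := ciInf_le hb t
  exact (mul_le_mul_of_nonneg_right h1 (dotProduct_self_nonneg' x)).trans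
    (lambdaMin_mul_le (h.trans_le h1) x)

/-! ### Uniformly bounded matrix sequences -/

/-- The entries of the matrices `M_t` are bounded uniformly in `t`. In finite dimensions this is
boundedness in any norm; the entrywise form makes sense for all index types. -/
def UniformlyBounded {ι κ : Type*} (M : ℕ → Matrix ι κ ℝ) : Prop :=
  ∃ c : ℝ, ∀ t i j, |M t i j| ≤ c

namespace UniformlyBounded

theorem exists_nonneg {ι κ : Type*} {M : ℕ → Matrix ι κ ℝ} (h : UniformlyBounded M) :
    ∃ c : ℝ, 0 ≤ c ∧ ∀ t i j, |M t i j| ≤ c := by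
  obtain ⟨c, hc⟩ := h
  exact ⟨max c 0, le_max_right _ _, fun t i j => (hc t i j).trans (le_max_left _ _)⟩

theorem add {ι κ : Type*} {M N : ℕ → Matrix ι κ ℝ} (hM : UniformlyBounded M)
    (hN : UniformlyBounded N) : UniformlyBounded fun t => M t + N t := by
  obtain ⟨a, ha⟩ := hM
  obtain ⟨b, hb⟩ := hN
  exact ⟨a + b, fun t i j => (abs_add_le _ _).trans (add_le_add (ha t i j) (hb t i j))⟩

theorem transpose {ι κ : Type*} {M : ℕ → Matrix ι κ ℝ} (hM : UniformlyBounded M) :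
    UniformlyBounded fun t => (M t)ᵀ := by
  obtain ⟨a, ha⟩ := hM
  exact ⟨a, fun t i j => ha t j i⟩

theorem mul {ι κ τ : Type*} [Fintype κ] {M : ℕ → Matrix ι κ ℝ} {N : ℕ → Matrix κ τ ℝ}
    (hM : UniformlyBounded M) (hN : UniformlyBounded N) :
    UniformlyBounded fun t => M t * N t := by
  obtain ⟨a, ha0, ha⟩ := hM.exists_nonneg
  obtain ⟨b, hb⟩ := hN
  refine ⟨∑ _k : κ, a * b, fun t i j => ?_⟩
  change |(M t * N t) i j| ≤ _
  rw [Matrix.mul_apply]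
  refine (Finset.abs_sum_le_sum_abs _ _).trans (Finset.sum_le_sum fun k _ => ?_)
  rw [abs_mul]
  exact mul_le_mul (ha t i k) (hb t k j) (abs_nonneg _) ha0

theorem const {ι κ : Type*} [Finite ι] [Finite κ] (M : Matrix ι κ ℝ) :
    UniformlyBounded fun _ => M := by
  obtain ⟨c, hc⟩ := (Set.finite_range fun p : ι × κ => |M p.1 p.2|).bddAbove
  exact ⟨c, fun _ i j => hc ⟨(i, j), rfl⟩⟩

theorem comp {ι κ : Type*} {M : ℕ → Matrix ι κ ℝ} (hM : UniformlyBounded M) (f : ℕ → ℕ) :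
    UniformlyBounded fun t => M (f t) := by
  obtain ⟨a, ha⟩ := hM
  exact ⟨a, fun t i j => ha (f t) i j⟩

theorem abs_det_le {ι : Type*} [Fintype ι] [DecidableEq ι] {M : ℕ → Matrix ι ι ℝ}
    (hM : UniformlyBounded M) : ∃ c : ℝ, ∀ t, |(M t).det| ≤ c := by
  obtain ⟨a, ha⟩ := hM
  exact ⟨_, fun t => Matrix.det_le (abv := AbsoluteValue.abs) (ha t)⟩

theorem adjugate {ι : Type*} [Fintype ι] [DecidableEq ι] {M : ℕ → Matrix ι ι ℝ}
    (hM : UniformlyBounded M) : UniformlyBounded fun t => (M t).adjugate := by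
  obtain ⟨a, ha⟩ := hM
  refine ⟨(Fintype.card ι).factorial • max a 1 ^ Fintype.card ι, fun t i j => ?_⟩
  change |(M t).adjugate i j| ≤ _
  rw [Matrix.adjugate_apply]
  refine Matrix.det_le (abv := AbsoluteValue.abs) (x := max a 1) fun k l => ?_
  change |_| ≤ _
  rw [Matrix.updateRow_apply]
  split_ifs
  · rw [Pi.single_apply]
    split_ifs <;> simp
  · exact (ha t k l).trans (le_max_left _ _)

theorem smul {ι κ : Type*} {M : ℕ → Matrix ι κ ℝ} (hM : UniformlyBounded M) {r : ℕ → ℝ} {c : ℝ}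
    (hr : ∀ t, |r t| ≤ c) : UniformlyBounded fun t => r t • M t := by
  obtain ⟨a, ha⟩ := hM
  refine ⟨c * a, fun t i j => ?_⟩
  change |r t * M t i j| ≤ _
  rw [abs_mul]
  exact mul_le_mul (hr t) (ha t i j) (abs_nonneg _) ((abs_nonneg _).trans (hr t))

theorem mulVec_le {ι κ : Type*} [Fintype ι] [Fintype κ] {M : ℕ → Matrix ι κ ℝ}
    (hM : UniformlyBounded M) :
    ∃ c : ℝ, 0 < c ∧ ∀ t x, (M t *ᵥ x) ⬝ᵥ (M t *ᵥ x) ≤ c * (x ⬝ᵥ x) := by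
  obtain ⟨a, ha⟩ := hM
  refine ⟨(∑ _i : ι, ∑ _j : κ, a ^ 2) + 1, by positivity, fun t x => ?_⟩
  have h1 : (M t *ᵥ x) ⬝ᵥ (M t *ᵥ x) ≤ (∑ _i : ι, ∑ _j : κ, a ^ 2) * (x ⬝ᵥ x) := by
    rw [dotProduct, Finset.sum_mul]
    refine Finset.sum_le_sum fun i _ => ?_
    rw [← sq]
    refine (dotProduct_sq_le (fun j => M t i j) x).trans
      (mul_le_mul_of_nonneg_right ?_ (dotProduct_self_nonneg' x))
    refine Finset.sum_le_sum fun j _ => ?_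
    rw [← sq]
    exact sq_le_sq' (abs_le.1 (ha t i j)).1 (abs_le.1 (ha t i j)).2
  linarith [dotProduct_self_nonneg' x]

theorem quadForm_le {ι : Type*} [Fintype ι] {M : ℕ → Matrix ι ι ℝ} (hM : UniformlyBounded M) :
    ∃ c : ℝ, 0 < c ∧ ∀ t x, quadForm (M t) x ≤ c * (x ⬝ᵥ x) := by
  obtain ⟨c, hc0, hc⟩ := hM.mulVec_le
  refine ⟨√c, Real.sqrt_pos.2 hc0, fun t x => ?_⟩
  refine le_of_sq_le_sq ?_ (mul_nonneg (Real.sqrt_nonneg _) (dotProduct_self_nonneg' x))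
  calc quadForm (M t) x ^ 2 ≤ (x ⬝ᵥ x) * ((M t *ᵥ x) ⬝ᵥ (M t *ᵥ x)) := dotProduct_sq_le _ _
    _ ≤ (x ⬝ᵥ x) * (c * (x ⬝ᵥ x)) :=
        mul_le_mul_of_nonneg_left (hc t x) (dotProduct_self_nonneg' x)
    _ = (√c * (x ⬝ᵥ x)) ^ 2 := by rw [mul_pow, Real.sq_sqrt hc0.le]; ring

theorem norm2_le {p q : ℕ} {M : ℕ → Matrix (Fin p) (Fin q) ℝ} (hM : UniformlyBounded M) :
    BddAbove (Set.range fun t => norm2 (M t)) := by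
  obtain ⟨c, hc0, hc⟩ := hM.mulVec_le
  refine ⟨√c, ?_⟩
  rintro _ ⟨t, rfl⟩
  exact LQR.norm2_le (Real.sqrt_nonneg _) fun x => by rw [Real.sq_sqrt hc0.le]; exact hc t x

theorem of_norm2_le {p q : ℕ} {M : ℕ → Matrix (Fin p) (Fin q) ℝ} {c : ℝ}
    (h : ∀ t, norm2 (M t) ≤ c) : UniformlyBounded M :=
  ⟨c, fun t i j => (abs_le_norm2 _ i j).trans (h t)⟩

theorem of_quadForm_le {ι : Type*} [Fintype ι] [DecidableEq ι] {M : ℕ → Matrix ι ι ℝ}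
    (hM : ∀ t, (M t).PosSemidef) {c : ℝ}
    (h : ∀ t x, quadForm (M t) x ≤ c * (x ⬝ᵥ x)) : UniformlyBounded M := by
  refine ⟨c, fun t i j => ?_⟩
  obtain ⟨hs, hn⟩ := posSemidef_iff.1 (hM t)
  have e (i j : ι) : (Pi.single i 1 : ι → ℝ) ⬝ᵥ (M t *ᵥ (Pi.single j 1)) = M t i j := by simp
  have hi := h t (Pi.single i 1)
  have hj := h t (Pi.single j 1)
  have h1 := hn (Pi.single i 1 + Pi.single j 1)
  have h2 := hn (Pi.single i 1 - Pi.single j 1)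
  rw [quadForm_add_vec hs, e] at h1
  rw [quadForm_sub_vec hs, e] at h2
  simp only [dotProduct_single_one, Pi.single_eq_same, mul_one] at hi hj
  rw [abs_le]
  constructor <;> linarith

theorem inv {ι : Type*} [Fintype ι] [DecidableEq ι] {M : ℕ → Matrix ι ι ℝ}
    (hM : ∀ t, (M t).PosDef) {q : ℝ} (hq : 0 < q)
    (h : ∀ t x, q * (x ⬝ᵥ x) ≤ quadForm (M t) x) : UniformlyBounded fun t => (M t)⁻¹ :=
  of_quadForm_le (fun t => (hM t).inv.posSemidef) fun t x => quadForm_inv_le (hM t) hq (h t) x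

end UniformlyBounded

end LQR

/-! ### One step of the Riccati recursion -/

namespace LQR

variable {ι κ : Type*} [Fintype ι] [Fintype κ] [DecidableEq κ]

/-- The Riccati operator of a stage with dynamics `x₊ = A x + B u` and cost `x' Q x + u' R u`. -/
noncomputable def riccMap (A : Matrix ι ι ℝ) (B : Matrix ι κ ℝ) (Q : Matrix ι ι ℝ)
    (R : Matrix κ κ ℝ) (P : Matrix ι ι ℝ) : Matrix ι ι ℝ :=
  Q + Aᵀ * (P - P * B * (R + Bᵀ * P * B)⁻¹ * Bᵀ * P) * A

/-- The gain `K` of the feedback `u = -K x` that is optimal for the terminal cost `P`. -/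
noncomputable def gainMap (A : Matrix ι ι ℝ) (B : Matrix ι κ ℝ) (R : Matrix κ κ ℝ)
    (P : Matrix ι ι ℝ) : Matrix κ ι ℝ :=
  (R + Bᵀ * P * B)⁻¹ * Bᵀ * P * A

variable {A : Matrix ι ι ℝ} {B : Matrix ι κ ℝ} {Q : Matrix ι ι ℝ} {R : Matrix κ κ ℝ}
  {P X : Matrix ι ι ℝ}

omit [DecidableEq κ] in
theorem posDef_hessian (B : Matrix ι κ ℝ) (hR : R.PosDef) (hP : P.PosSemidef) :
    (R + Bᵀ * P * B).PosDef := by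
  have := hP.conjTranspose_mul_mul_same B
  rw [Matrix.conjTranspose_eq_transpose_of_trivial] at this
  exact hR.add_posSemidef this

theorem hessian_mulVec_gainMap (A : Matrix ι ι ℝ) (B : Matrix ι κ ℝ) (hR : R.PosDef)
    (hP : P.PosSemidef) (x : ι → ℝ) :
    (R + Bᵀ * P * B) *ᵥ (gainMap A B R P *ᵥ x) = Bᵀ *ᵥ (P *ᵥ (A *ᵥ x)) := by
  simp only [gainMap, ← Matrix.mulVec_mulVec]
  exact mulVec_inv_mulVec (posDef_hessian B hR hP) _

/-- Completing the square in the input `u`. -/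
theorem stage_cost_eq (A : Matrix ι ι ℝ) (B : Matrix ι κ ℝ) (Q : Matrix ι ι ℝ) (hR : R.PosDef)
    (hP : P.PosSemidef) (x : ι → ℝ) (u : κ → ℝ) :
    quadForm Q x + quadForm R u + quadForm P (A *ᵥ x + B *ᵥ u) =
      quadForm (riccMap A B Q R P) x +
        quadForm (R + Bᵀ * P * B) (u + gainMap A B R P *ᵥ x) := by
  have hM := posDef_hessian B hR hP
  have hPs := (posSemidef_iff.1 hP).1
  have hK := hessian_mulVec_gainMap A B hR hP x
  rw [quadForm_add_vec hPs, quadForm_add_vec (posDef_iff.1 hM).1, hK, quadForm_add R,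
    quadForm_transpose_mul_mul, riccMap, quadForm_add Q, quadForm_transpose_mul_mul, quadForm_sub]
  have h1 : quadForm (P * B * (R + Bᵀ * P * B)⁻¹ * Bᵀ * P) (A *ᵥ x) =
      quadForm (R + Bᵀ * P * B) (gainMap A B R P *ᵥ x) := by
    rw [quadForm, quadForm, hK]
    simp only [gainMap, ← Matrix.mulVec_mulVec]
    rw [dotProduct_mulVec_symm hPs, dotProduct_mulVec_transpose, dotProduct_comm]
  have h2 : (A *ᵥ x) ⬝ᵥ (P *ᵥ (B *ᵥ u)) = u ⬝ᵥ (Bᵀ *ᵥ (P *ᵥ (A *ᵥ x))) := by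
    rw [dotProduct_mulVec_transpose, dotProduct_mulVec_symm hPs]
  rw [h1, h2]
  ring

theorem transpose_riccMap (A : Matrix ι ι ℝ) (B : Matrix ι κ ℝ) (hQ : Qᵀ = Q) (hR : R.PosDef)
    (hP : P.PosSemidef) : (riccMap A B Q R P)ᵀ = riccMap A B Q R P := by
  have hM := transpose_inv_of_symm (posDef_iff.1 (posDef_hessian B hR hP)).1
  have hPs := (posSemidef_iff.1 hP).1
  simp only [riccMap, Matrix.transpose_add, Matrix.transpose_mul, Matrix.transpose_sub,
    Matrix.transpose_transpose, hQ, hPs, hM]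
  simp only [Matrix.mul_assoc]

theorem riccMap_le_stage_cost (A : Matrix ι ι ℝ) (B : Matrix ι κ ℝ) (Q : Matrix ι ι ℝ)
    (hR : R.PosDef) (hP : P.PosSemidef) (x : ι → ℝ) (u : κ → ℝ) :
    quadForm (riccMap A B Q R P) x ≤
      quadForm Q x + quadForm R u + quadForm P (A *ᵥ x + B *ᵥ u) := by
  rw [stage_cost_eq A B Q hR hP]
  exact le_add_of_nonneg_right
    ((posSemidef_iff.1 (posDef_hessian B hR hP).posSemidef).2 _)

theorem riccMap_eq_stage_cost (A : Matrix ι ι ℝ) (B : Matrix ι κ ℝ) (Q : Matrix ι ι ℝ)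
    (hR : R.PosDef) (hP : P.PosSemidef) (x : ι → ℝ) :
    quadForm (riccMap A B Q R P) x = quadForm Q x + quadForm R (-(gainMap A B R P *ᵥ x)) +
      quadForm P (A *ᵥ x + B *ᵥ (-(gainMap A B R P *ᵥ x))) := by
  rw [stage_cost_eq A B Q hR hP, neg_add_cancel, quadForm_zero_vec, add_zero]

theorem le_riccMap (A : Matrix ι ι ℝ) (B : Matrix ι κ ℝ) (Q : Matrix ι ι ℝ) (hR : R.PosDef)
    (hP : P.PosSemidef) (x : ι → ℝ) : quadForm Q x ≤ quadForm (riccMap A B Q R P) x := by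
  rw [riccMap_eq_stage_cost A B Q hR hP]
  have h1 := (posSemidef_iff.1 hR.posSemidef).2 (-(gainMap A B R P *ᵥ x))
  have h2 := (posSemidef_iff.1 hP).2 (A *ᵥ x + B *ᵥ (-(gainMap A B R P *ᵥ x)))
  linarith

theorem posDef_riccMap (A : Matrix ι ι ℝ) (B : Matrix ι κ ℝ) (hQ : Q.PosDef) (hR : R.PosDef)
    (hP : P.PosSemidef) : (riccMap A B Q R P).PosDef :=
  posDef_iff.2 ⟨transpose_riccMap A B (posDef_iff.1 hQ).1 hR hP, fun x hx =>
    ((posDef_iff.1 hQ).2 x hx).trans_le (le_riccMap A B Q hR hP x)⟩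

/-- The Riccati operator is monotone and, for `c ≥ 1`, satisfies `ℛ(c P) ≤ c ℛ(P)`. -/
theorem riccMap_le_mul (A : Matrix ι ι ℝ) (B : Matrix ι κ ℝ) (hQ : Q.PosDef) (hR : R.PosDef)
    (hX : X.PosSemidef) (hP : P.PosSemidef) {c : ℝ} (hc : 1 ≤ c)
    (h : ∀ x, quadForm X x ≤ c * quadForm P x) (x : ι → ℝ) :
    quadForm (riccMap A B Q R X) x ≤ c * quadForm (riccMap A B Q R P) x := by
  rw [riccMap_eq_stage_cost A B Q hR hP]
  set u := -(gainMap A B R P *ᵥ x)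
  refine (riccMap_le_stage_cost A B Q hR hX x u).trans ?_
  have h1 := h (A *ᵥ x + B *ᵥ u)
  have h2 := mul_le_mul_of_nonneg_right hc ((posSemidef_iff.1 hQ.posSemidef).2 x)
  have h3 := mul_le_mul_of_nonneg_right hc ((posSemidef_iff.1 hR.posSemidef).2 u)
  linarith

theorem riccMap_mono (A : Matrix ι ι ℝ) (B : Matrix ι κ ℝ) (hQ : Q.PosDef) (hR : R.PosDef)
    (hX : X.PosSemidef) (hP : P.PosSemidef) (h : ∀ x, quadForm X x ≤ quadForm P x) (x : ι → ℝ) :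
    quadForm (riccMap A B Q R X) x ≤ quadForm (riccMap A B Q R P) x := by
  have := riccMap_le_mul A B hQ hR hX hP le_rfl (by simpa using h) x
  rwa [one_mul] at this

theorem closed_loop_ne_zero [DecidableEq ι] (B : Matrix ι κ ℝ) (hA : IsUnit A) (hR : R.PosDef)
    (hP : P.PosSemidef) {x : ι → ℝ} (hx : x ≠ 0) :
    A *ᵥ x + B *ᵥ (-(gainMap A B R P *ᵥ x)) ≠ 0 := by
  intro h
  have hK := hessian_mulVec_gainMap A B hR hP x
  rw [Matrix.mulVec_neg] at h
  have hAx := add_neg_eq_zero.1 h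
  have hRK : R *ᵥ (gainMap A B R P *ᵥ x) = 0 := by
    rw [Matrix.add_mulVec, ← Matrix.mulVec_mulVec, ← Matrix.mulVec_mulVec, ← hAx] at hK
    simpa using hK
  have hK0 : gainMap A B R P *ᵥ x = 0 := by
    by_contra hne
    have := (posDef_iff.1 hR).2 _ hne
    rw [quadForm, hRK, dotProduct_zero] at this
    exact lt_irrefl _ this
  rw [hK0, Matrix.mulVec_zero] at hAx
  exact hx (Matrix.mulVec_injective_iff_isUnit.2 hA (by simpa using hAx))

section Deadbeat

variable [DecidableEq ι]

/-- The gain of the deadbeat feedback `u = -D x`: it drives the state to the origin in one step. -/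
noncomputable def deadbeatGain (A : Matrix ι ι ℝ) (B : Matrix ι κ ℝ) : Matrix κ ι ℝ :=
  Bᵀ * (B * Bᵀ)⁻¹ * A

/-- The cost matrix of the deadbeat feedback. -/
noncomputable def deadbeatCost (A : Matrix ι ι ℝ) (B : Matrix ι κ ℝ) (Q : Matrix ι ι ℝ)
    (R : Matrix κ κ ℝ) : Matrix ι ι ℝ :=
  Q + Aᵀ * (B * Bᵀ)⁻¹ * B * R * Bᵀ * (B * Bᵀ)⁻¹ * A

omit [DecidableEq κ] in
theorem deadbeatCost_eq (A : Matrix ι ι ℝ) (B : Matrix ι κ ℝ) (Q : Matrix ι ι ℝ)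
    (R : Matrix κ κ ℝ) :
    deadbeatCost A B Q R = Q + (deadbeatGain A B)ᵀ * R * deadbeatGain A B := by
  have h : (B * Bᵀ)⁻¹ᵀ = (B * Bᵀ)⁻¹ := transpose_inv_of_symm (by simp)
  simp only [deadbeatCost, deadbeatGain, Matrix.transpose_mul, Matrix.transpose_transpose, h,
    Matrix.mul_assoc]

omit [DecidableEq κ] in
theorem deadbeat_next_eq_zero (A : Matrix ι ι ℝ) (hB : (B * Bᵀ).PosDef) (x : ι → ℝ) :
    A *ᵥ x + B *ᵥ (-(deadbeatGain A B *ᵥ x)) = 0 := by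
  rw [Matrix.mulVec_neg, Matrix.mulVec_mulVec, deadbeatGain, ← Matrix.mul_assoc,
    ← Matrix.mul_assoc, mul_inv_of_posDef hB, Matrix.one_mul, add_neg_cancel]

omit [DecidableEq κ] in
theorem posDef_deadbeatCost (A : Matrix ι ι ℝ) (B : Matrix ι κ ℝ) (hQ : Q.PosDef)
    (hR : R.PosDef) : (deadbeatCost A B Q R).PosDef := by
  rw [deadbeatCost_eq]
  have := hR.posSemidef.conjTranspose_mul_mul_same (deadbeatGain A B)
  rw [Matrix.conjTranspose_eq_transpose_of_trivial] at this
  exact hQ.add_posSemidef this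

/-- The deadbeat feedback is never better than the optimal one, whatever the terminal cost. -/
theorem riccMap_le_deadbeatCost (A : Matrix ι ι ℝ) (hB : (B * Bᵀ).PosDef) (Q : Matrix ι ι ℝ)
    (hR : R.PosDef) (hP : P.PosSemidef) (x : ι → ℝ) :
    quadForm (riccMap A B Q R P) x ≤ quadForm (deadbeatCost A B Q R) x := by
  have := riccMap_le_stage_cost A B Q hR hP x (-(deadbeatGain A B *ᵥ x))
  rw [deadbeat_next_eq_zero A hB, quadForm_zero_vec, quadForm_neg_vec, add_zero] at this
  rwa [deadbeatCost_eq, quadForm_add, quadForm_transpose_mul_mul]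

/-- The optimal feedback leads to a nonzero state, hence differs from the deadbeat feedback. -/
theorem riccMap_lt_deadbeatCost (hA : IsUnit A) (hB : (B * Bᵀ).PosDef) (Q : Matrix ι ι ℝ)
    (hR : R.PosDef) (hP : P.PosSemidef) {x : ι → ℝ} (hx : x ≠ 0) :
    quadForm (riccMap A B Q R P) x < quadForm (deadbeatCost A B Q R) x := by
  have h := stage_cost_eq A B Q hR hP x (-(deadbeatGain A B *ᵥ x))
  rw [deadbeat_next_eq_zero A hB, quadForm_zero_vec, quadForm_neg_vec, add_zero] at h
  rw [deadbeatCost_eq, quadForm_add, quadForm_transpose_mul_mul, h, lt_add_iff_pos_right]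
  refine (posDef_iff.1 (posDef_hessian B hR hP)).2 _ fun h0 => ?_
  refine closed_loop_ne_zero B hA hR hP hx ?_
  rw [← neg_eq_of_add_eq_zero_right h0, neg_neg]
  exact deadbeat_next_eq_zero A hB x

end Deadbeat

/-! ### Contraction of the Riccati operator -/

section Contraction

variable [DecidableEq ι]

/-- The matrix `W = Q + Q A⁻¹ B R⁻¹ B' A'⁻¹ Q`. -/
noncomputable def zetaMat (A : Matrix ι ι ℝ) (B : Matrix ι κ ℝ) (Q : Matrix ι ι ℝ)
    (R : Matrix κ κ ℝ) : Matrix ι ι ℝ :=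
  Q + Q * A⁻¹ * B * R⁻¹ * Bᵀ * (Aᵀ)⁻¹ * Q

/-- The matrix `E = A⁻¹ B (R + B' A'⁻¹ Q A⁻¹ B)⁻¹ B' A'⁻¹`. -/
noncomputable def epsMat (A : Matrix ι ι ℝ) (B : Matrix ι κ ℝ) (Q : Matrix ι ι ℝ)
    (R : Matrix κ κ ℝ) : Matrix ι ι ℝ :=
  A⁻¹ * B * (R + Bᵀ * (Aᵀ)⁻¹ * Q * A⁻¹ * B)⁻¹ * Bᵀ * (Aᵀ)⁻¹

theorem posDef_zetaMat (A : Matrix ι ι ℝ) (B : Matrix ι κ ℝ) (hQ : Q.PosDef) (hR : R.PosDef) :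
    (zetaMat A B Q R).PosDef := by
  have h := hR.inv.posSemidef.conjTranspose_mul_mul_same (Bᵀ * (Aᵀ)⁻¹ * Q)
  have e : (Bᵀ * (Aᵀ)⁻¹ * Q)ᴴ * R⁻¹ * (Bᵀ * (Aᵀ)⁻¹ * Q) =
      Q * A⁻¹ * B * R⁻¹ * Bᵀ * (Aᵀ)⁻¹ * Q := by
    rw [Matrix.conjTranspose_eq_transpose_of_trivial]
    simp only [Matrix.transpose_mul, Matrix.transpose_transpose, (posDef_iff.1 hQ).1,
      Matrix.transpose_nonsing_inv, Matrix.mul_assoc]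
  rw [e] at h
  exact hQ.add_posSemidef h

omit [DecidableEq κ] in
theorem posDef_epsHessian (A : Matrix ι ι ℝ) (B : Matrix ι κ ℝ) (hQ : Q.PosDef) (hR : R.PosDef) :
    (R + Bᵀ * (Aᵀ)⁻¹ * Q * A⁻¹ * B).PosDef := by
  have h := posDef_hessian (A⁻¹ * B) hR hQ.posSemidef
  simpa only [Matrix.transpose_mul, Matrix.transpose_nonsing_inv, Matrix.mul_assoc] using h

theorem inv_zetaMat (A : Matrix ι ι ℝ) (B : Matrix ι κ ℝ) (hQ : Q.PosDef) (hR : R.PosDef) :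
    (zetaMat A B Q R)⁻¹ = Q⁻¹ - epsMat A B Q R := by
  have hM := posDef_epsHessian A B hQ hR
  refine Matrix.inv_eq_right_inv ?_
  have key : A⁻¹ * B * R⁻¹ * Bᵀ * (Aᵀ)⁻¹ * Q * epsMat A B Q R =
      A⁻¹ * B * R⁻¹ * Bᵀ * (Aᵀ)⁻¹ - epsMat A B Q R := by
    set M := R + Bᵀ * (Aᵀ)⁻¹ * Q * A⁻¹ * B with hMdef
    have h1 : Bᵀ * (Aᵀ)⁻¹ * Q * A⁻¹ * B = M - R := by rw [hMdef]; abel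
    calc A⁻¹ * B * R⁻¹ * Bᵀ * (Aᵀ)⁻¹ * Q * epsMat A B Q R
        = A⁻¹ * B * R⁻¹ * (Bᵀ * (Aᵀ)⁻¹ * Q * A⁻¹ * B) * M⁻¹ * Bᵀ * (Aᵀ)⁻¹ := by
          simp only [epsMat, hMdef, Matrix.mul_assoc]
      _ = A⁻¹ * B * (R⁻¹ * (M * M⁻¹) - R⁻¹ * R * M⁻¹) * Bᵀ * (Aᵀ)⁻¹ := by
          rw [h1]
          simp only [Matrix.mul_sub, Matrix.sub_mul, Matrix.mul_assoc]
      _ = _ := by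
          rw [mul_inv_of_posDef hM, inv_mul_of_posDef hR, epsMat, ← hMdef]
          simp only [Matrix.mul_sub, Matrix.sub_mul, Matrix.mul_assoc, Matrix.mul_one,
            Matrix.one_mul]
  have e : zetaMat A B Q R = Q + Q * (A⁻¹ * B * R⁻¹ * Bᵀ * (Aᵀ)⁻¹ * Q) := by
    simp only [zetaMat, Matrix.mul_assoc]
  rw [e, Matrix.mul_sub, Matrix.add_mul, Matrix.add_mul, Matrix.mul_assoc Q _ (epsMat A B Q R),
    key, Matrix.mul_sub, mul_inv_of_posDef hQ, Matrix.mul_assoc Q, Matrix.mul_assoc _ Q Q⁻¹,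
    mul_inv_of_posDef hQ, Matrix.mul_one]
  abel

theorem inv_riccMap (B : Matrix ι κ ℝ) (hA : IsUnit A) (hQ : Q.PosDef) (hR : R.PosDef)
    (hP : P.PosDef) :
    (zetaMat A B Q R + Q * A⁻¹ * P⁻¹ * (Aᵀ)⁻¹ * Q)⁻¹ = Q⁻¹ - (riccMap A B Q R P)⁻¹ := by
  have hM := posDef_hessian B hR hP.posSemidef
  have hPi := posDef_riccMap A B hQ hR hP.posSemidef
  have hAd : IsUnit A.det := (Matrix.isUnit_iff_isUnit_det _).1 hA
  have hAd' : IsUnit Aᵀ.det := by rwa [Matrix.det_transpose]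
  set M := R + Bᵀ * P * B with hMdef
  set L := P - P * B * M⁻¹ * Bᵀ * P with hL
  set H := A⁻¹ * (P⁻¹ + B * R⁻¹ * Bᵀ) * (Aᵀ)⁻¹ with hH
  have h1 : (P⁻¹ + B * R⁻¹ * Bᵀ) * L = 1 := by
    have h2 : Bᵀ * P * B = M - R := by rw [hMdef]; abel
    calc (P⁻¹ + B * R⁻¹ * Bᵀ) * L
        = P⁻¹ * P - P⁻¹ * P * B * M⁻¹ * Bᵀ * P + B * R⁻¹ * Bᵀ * P -
            B * R⁻¹ * (Bᵀ * P * B) * M⁻¹ * Bᵀ * P := by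
          rw [hL]
          simp only [Matrix.mul_sub, Matrix.add_mul, Matrix.mul_assoc]
          abel
      _ = 1 - B * M⁻¹ * Bᵀ * P + B * R⁻¹ * Bᵀ * P -
            B * (R⁻¹ * (M * M⁻¹) - R⁻¹ * R * M⁻¹) * Bᵀ * P := by
          rw [h2, inv_mul_of_posDef hP]
          simp only [Matrix.mul_sub, Matrix.sub_mul, Matrix.mul_assoc, Matrix.one_mul]
      _ = 1 := by
          rw [mul_inv_of_posDef hM, inv_mul_of_posDef hR]
          simp only [Matrix.mul_sub, Matrix.sub_mul, Matrix.mul_assoc, Matrix.mul_one,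
            Matrix.one_mul]
          abel
  have hHG : H * (Aᵀ * L * A) = 1 := by
    calc H * (Aᵀ * L * A)
        = A⁻¹ * (P⁻¹ + B * R⁻¹ * Bᵀ) * ((Aᵀ)⁻¹ * Aᵀ) * L * A := by
          rw [hH]; simp only [Matrix.mul_assoc]
      _ = A⁻¹ * ((P⁻¹ + B * R⁻¹ * Bᵀ) * L) * A := by
          rw [Matrix.nonsing_inv_mul _ hAd', Matrix.mul_one]; simp only [Matrix.mul_assoc]
      _ = 1 := by rw [h1, Matrix.mul_one, Matrix.nonsing_inv_mul _ hAd]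
  have hF : zetaMat A B Q R + Q * A⁻¹ * P⁻¹ * (Aᵀ)⁻¹ * Q = Q + Q * H * Q := by
    rw [hH, zetaMat]
    simp only [Matrix.mul_add, Matrix.add_mul, Matrix.mul_assoc]
    abel
  have hF' : Q + Q * H * Q = Q * H * riccMap A B Q R P := by
    rw [riccMap, ← hMdef, ← hL, Matrix.mul_add, Matrix.mul_assoc Q H (Aᵀ * L * A), hHG,
      Matrix.mul_one, add_comm]
  refine Matrix.inv_eq_right_inv ?_
  rw [hF, Matrix.mul_sub, Matrix.add_mul, mul_inv_of_posDef hQ, Matrix.mul_assoc _ Q Q⁻¹,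
    mul_inv_of_posDef hQ, Matrix.mul_one, hF', Matrix.mul_assoc _ _ (riccMap A B Q R P)⁻¹,
    mul_inv_of_posDef hPi, Matrix.mul_one]
  abel

theorem inv_smul_of_posDef {c : ℝ} (hc : 0 < c) (hP : P.PosDef) : (c • P)⁻¹ = c⁻¹ • P⁻¹ := by
  refine Matrix.inv_eq_right_inv ?_
  rw [Matrix.smul_mul, Matrix.mul_smul, smul_smul, mul_inv_cancel₀ hc.ne', one_smul,
    mul_inv_of_posDef hP]

/-- As a function of `P⁻¹`, the inverse of `ℛ(P)` is concave, with value `E` at `P⁻¹ = 0`. Since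
`E ≥ ε` and `ℛ(P)⁻¹ - E ≤ W⁻¹ ≤ ζ`, this improves the factor `s` in `s X ≤ P`
to `(1 - ρ) + ρ s`, where `ρ = ζ / (ζ + ε)`. -/
theorem riccMap_contraction_affine (B : Matrix ι κ ℝ) (hA : IsUnit A) (hQ : Q.PosDef)
    (hR : R.PosDef) (hX : X.PosSemidef) (hP : P.PosDef) {ζ ε s : ℝ} (hζ : 0 < ζ) (hε : 0 < ε)
    (hζW : ∀ x, quadForm (zetaMat A B Q R)⁻¹ x ≤ ζ * (x ⬝ᵥ x))
    (hεE : ∀ x, ε * (x ⬝ᵥ x) ≤ quadForm (epsMat A B Q R) x)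
    (hs0 : 0 < s) (hs1 : s ≤ 1) (h : ∀ x, s * quadForm X x ≤ quadForm P x) (x : ι → ℝ) :
    (1 - ζ / (ζ + ε) + ζ / (ζ + ε) * s) * quadForm (riccMap A B Q R X) x ≤
      quadForm (riccMap A B Q R P) x := by
  set ρ := ζ / (ζ + ε) with hρ
  have hρ0 : 0 < ρ := by positivity
  have hρ1 : ρ < 1 := by rw [hρ, div_lt_one (by positivity)]; linarith
  have hr : 0 < 1 - ρ + ρ * s := by
    have := mul_pos hρ0 hs0
    linarith
  set r := 1 - ρ + ρ * s
  have hsP : (s⁻¹ • P).PosDef := hP.smul (inv_pos.2 hs0)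
  have hW := posDef_zetaMat A B hQ hR
  have hPi := posDef_riccMap A B hQ hR hP.posSemidef
  have hPis := posDef_riccMap A B hQ hR hsP.posSemidef
  have hpsd (c : ℝ) (hc : 0 ≤ c) :
      (zetaMat A B Q R + c • (Q * A⁻¹ * P⁻¹ * (Aᵀ)⁻¹ * Q)).PosDef := by
    have h1 := hP.inv.posSemidef.conjTranspose_mul_mul_same ((Aᵀ)⁻¹ * Q)
    have e : ((Aᵀ)⁻¹ * Q)ᴴ * P⁻¹ * ((Aᵀ)⁻¹ * Q) = Q * A⁻¹ * P⁻¹ * (Aᵀ)⁻¹ * Q := by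
      rw [Matrix.conjTranspose_eq_transpose_of_trivial]
      simp only [Matrix.transpose_mul, Matrix.transpose_transpose, (posDef_iff.1 hQ).1,
        Matrix.transpose_nonsing_inv, Matrix.mul_assoc]
    rw [e] at h1
    exact hW.add_posSemidef (h1.smul hc)
  have hF := hpsd 1 zero_le_one
  rw [one_smul] at hF
  have hFs := hpsd s hs0.le
  have ePi := inv_riccMap B hA hQ hR hP
  have ePis := inv_riccMap B hA hQ hR hsP
  rw [inv_smul_of_posDef (inv_pos.2 hs0) hP, inv_inv, Matrix.mul_smul, Matrix.smul_mul,
    Matrix.smul_mul] at ePis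
  have eW := inv_zetaMat A B hQ hR
  have hconv := quadForm_inv_convex hW hF hFs hs0.le hs1 (by
    rw [smul_add, ← add_assoc, ← add_smul, sub_add_cancel, one_smul])
  have hFpos : ∀ y, 0 ≤ quadForm
      (zetaMat A B Q R + Q * A⁻¹ * P⁻¹ * (Aᵀ)⁻¹ * Q)⁻¹ y :=
    (posSemidef_iff.1 hF.inv.posSemidef).2
  have hinv : ∀ y, quadForm (r⁻¹ • riccMap A B Q R P)⁻¹ y ≤
      quadForm (riccMap A B Q R (s⁻¹ • P))⁻¹ y := by
    intro y
    rw [inv_smul_of_posDef (inv_pos.2 hr) hPi, inv_inv, quadForm_smul]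
    have h1 := hconv y
    have h2 := hFpos y
    have h3 := hζW y
    have h4 := hεE y
    rw [ePi] at h1 h2
    rw [ePis, eW] at h1
    rw [eW] at h3
    simp only [quadForm_sub] at h1 h2 h3
    set q := quadForm Q⁻¹ y
    set e := quadForm (epsMat A B Q R) y
    set π := quadForm (riccMap A B Q R P)⁻¹ y
    -- `E ≥ (1 - ρ) ℛ(P)⁻¹`, the balance between `ε` and `ζ` that defines `ρ`
    have h5 : (1 - ρ) * π ≤ e := by
      have e1 : 1 - ρ = ε / (ζ + ε) := by rw [hρ]; field_simp; ring
      rw [e1, div_mul_eq_mul_div, div_le_iff₀ (by positivity)]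
      have h6 : ε * (q - e) ≤ ζ * e := by
        calc ε * (q - e) ≤ ε * (ζ * (y ⬝ᵥ y)) := mul_le_mul_of_nonneg_left h3 hε.le
          _ = ζ * (ε * (y ⬝ᵥ y)) := by ring
          _ ≤ ζ * e := mul_le_mul_of_nonneg_left h4 hζ.le
      nlinarith
    have h7 := mul_le_mul_of_nonneg_left h5 (sub_nonneg.2 hs1)
    have h8 : r * π = (1 - s) * ((1 - ρ) * π) + s * π := by ring
    linarith
  have h1 := quadForm_le_of_inv_le hPis (hPi.smul (inv_pos.2 hr)) hinv x
  rw [quadForm_smul, ← div_eq_inv_mul, le_div_iff₀ hr] at h1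
  have h2 := riccMap_mono A B hQ hR hX hsP.posSemidef (fun x => by
    rw [quadForm_smul, ← div_eq_inv_mul, le_div_iff₀ hs0, mul_comm]
    exact h x) x
  rw [mul_comm]
  exact (mul_le_mul_of_nonneg_right h2 hr.le).trans h1

/-- The Riccati operator contracts the logarithm of the ratio of two matrices by `ρ = ζ/(ζ+ε)`. -/
theorem riccMap_contraction (B : Matrix ι κ ℝ) (hA : IsUnit A) (hQ : Q.PosDef)
    (hR : R.PosDef) (hX : X.PosSemidef) (hP : P.PosDef) {ζ ε α : ℝ} (hζ : 0 < ζ) (hε : 0 < ε)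
    (hζW : ∀ x, quadForm (zetaMat A B Q R)⁻¹ x ≤ ζ * (x ⬝ᵥ x))
    (hεE : ∀ x, ε * (x ⬝ᵥ x) ≤ quadForm (epsMat A B Q R) x)
    (hα : 1 ≤ α) (h : ∀ x, quadForm X x ≤ α * quadForm P x) (x : ι → ℝ) :
    quadForm (riccMap A B Q R X) x ≤
      α ^ (ζ / (ζ + ε)) * quadForm (riccMap A B Q R P) x := by
  have hα0 : 0 < α := by linarith
  set ρ := ζ / (ζ + ε) with hρ
  have hρ0 : 0 < ρ := by positivity
  have hρ1 : ρ < 1 := by rw [hρ, div_lt_one (by positivity)]; linarith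
  have h1 := riccMap_contraction_affine B hA hQ hR hX hP hζ hε hζW hεE (inv_pos.2 hα0)
    (inv_le_one_of_one_le₀ hα) (fun x => by
      rw [← div_eq_inv_mul, div_le_iff₀ hα0, mul_comm]; exact h x) x
  rw [← hρ] at h1
  have h2 : (α ^ ρ)⁻¹ ≤ 1 - ρ + ρ * α⁻¹ := by
    have := Real.geom_mean_le_arith_mean2_weighted (sub_nonneg.2 hρ1.le) hρ0.le zero_le_one
      (inv_nonneg.2 hα0.le) (by ring)
    rwa [Real.one_rpow, one_mul, mul_one, Real.inv_rpow hα0.le] at this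
  have hpos : 0 < α ^ ρ := Real.rpow_pos_of_pos hα0 _
  have h3 : 0 ≤ quadForm (riccMap A B Q R X) x :=
    (posSemidef_iff.1 (posDef_riccMap A B hQ hR hX).posSemidef).2 x
  have h4 := (mul_le_mul_of_nonneg_right h2 h3).trans h1
  rwa [← div_eq_inv_mul, div_le_iff₀ hpos, mul_comm] at h4

end Contraction

end LQR

/-! ### Limits of matrices -/

namespace LQR

open Filter Topology

variable {ι κ : Type*} [Fintype ι] [Fintype κ] [DecidableEq ι] [DecidableEq κ]

theorem apply_eq_quadForm {M : Matrix ι ι ℝ} (hM : Mᵀ = M) (i j : ι) :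
    M i j = (quadForm M (Pi.single i 1 + Pi.single j 1) - quadForm M (Pi.single i 1) -
      quadForm M (Pi.single j 1)) / 2 := by
  rw [quadForm_add_vec hM]
  simp only [Matrix.mulVec_single_one, Matrix.col_apply, single_one_dotProduct]
  ring

/-- A symmetric matrix is determined by its quadratic form. -/
theorem eq_of_quadForm_eq {M N : Matrix ι ι ℝ} (hM : Mᵀ = M) (hN : Nᵀ = N)
    (h : ∀ x, quadForm M x = quadForm N x) : M = N := by
  ext i j
  rw [apply_eq_quadForm hM, apply_eq_quadForm hN, h, h, h]

omit [DecidableEq ι] in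
theorem continuous_quadForm (x : ι → ℝ) : Continuous fun M : Matrix ι ι ℝ => quadForm M x := by
  unfold quadForm
  fun_prop

/-- A sequence of positive semidefinite matrices that decreases in the Loewner order converges. -/
theorem exists_tendsto_of_antitone {M : ℕ → Matrix ι ι ℝ} (hM : ∀ k, (M k).PosSemidef)
    (hanti : ∀ k x, quadForm (M (k + 1)) x ≤ quadForm (M k) x) :
    ∃ L : Matrix ι ι ℝ, L.PosSemidef ∧ Tendsto M atTop (𝓝 L) := by
  have hform (x : ι → ℝ) : ∃ l, Tendsto (fun k => quadForm (M k) x) atTop (𝓝 l) :=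
    ⟨_, tendsto_atTop_ciInf (antitone_nat_of_succ_le fun k => hanti k x)
      ⟨0, by rintro _ ⟨k, rfl⟩; exact (posSemidef_iff.1 (hM k)).2 x⟩⟩
  choose l hl using hform
  have hL : Tendsto M atTop (𝓝 (Matrix.of fun i j =>
      (l (Pi.single i 1 + Pi.single j 1) - l (Pi.single i 1) - l (Pi.single j 1)) / 2)) := by
    refine tendsto_pi_nhds.2 fun i => tendsto_pi_nhds.2 fun j => ?_
    have := (((hl (Pi.single i 1 + Pi.single j 1)).sub (hl (Pi.single i 1))).sub
      (hl (Pi.single j 1))).div_const 2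
    refine this.congr fun k => ?_
    exact (apply_eq_quadForm (posSemidef_iff.1 (hM k)).1 i j).symm
  refine ⟨_, posSemidef_iff.2 ⟨?_, fun x => ?_⟩, hL⟩
  · refine tendsto_nhds_unique
      (((continuous_id.matrix_transpose).tendsto _).comp hL) (hL.congr fun k => ?_)
    exact (posSemidef_iff.1 (hM k)).1.symm
  · exact ge_of_tendsto' (((continuous_quadForm x).tendsto _).comp hL)
      fun k => (posSemidef_iff.1 (hM k)).2 x

omit [DecidableEq ι] in
theorem tendsto_riccMap (A : Matrix ι ι ℝ) (B : Matrix ι κ ℝ) (Q : Matrix ι ι ℝ)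
    {R : Matrix κ κ ℝ} (hR : R.PosDef) {M : ℕ → Matrix ι ι ℝ} {L : Matrix ι ι ℝ}
    (hL : L.PosSemidef) (h : Tendsto M atTop (𝓝 L)) :
    Tendsto (fun k => riccMap A B Q R (M k)) atTop (𝓝 (riccMap A B Q R L)) := by
  have hdet : (R + Bᵀ * L * B).det ≠ 0 := (posDef_hessian B hR hL).det_pos.ne'
  have hhess : Tendsto (fun k => R + Bᵀ * M k * B) atTop (𝓝 (R + Bᵀ * L * B)) := by
    have hc : Continuous (fun P : Matrix ι ι ℝ => R + Bᵀ * P * B) := by fun_prop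
    exact (hc.tendsto L).comp h
  have hinv : Tendsto (fun k => (R + Bᵀ * M k * B)⁻¹) atTop (𝓝 (R + Bᵀ * L * B)⁻¹) := by
    have hc : ContinuousAt (fun N : Matrix κ κ ℝ => N⁻¹) (R + Bᵀ * L * B) :=
      continuousAt_matrix_inv _ (by simpa using continuousAt_inv₀ hdet)
    exact hc.tendsto.comp hhess
  have hc : Continuous fun p : Matrix ι ι ℝ × Matrix κ κ ℝ =>
      Q + Aᵀ * (p.1 - p.1 * B * p.2 * Bᵀ * p.1) * A := by fun_prop
  have hlim := (hc.tendsto (L, (R + Bᵀ * L * B)⁻¹)).comp (h.prodMk_nhds hinv)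
  simpa only [riccMap, Function.comp_def] using hlim

end LQR

/-! ### The Riccati recursion of the lifted problem -/

namespace LQRData

open LQR Filter Topology

variable {n m d : ℕ} {S : LQRData n m}

/-- The standing assumptions on a time-varying linear-quadratic problem, here for the lifted data:
bounded coefficients, boundedly invertible state matrices, uniformly positive state cost and
uniformly surjective input matrices. The input cost is only required to be positive definite
for each `t`. -/
structure IsUniform (S : LQRData n m) (d : ℕ) : Prop where
  posDef_Rt : ∀ t, (S.Rt d t).PosDef
  transpose_Qt : ∀ t, (S.Qt d t)ᵀ = S.Qt d t
  exists_le_Qt : ∃ q : ℝ, 0 < q ∧ ∀ t x, q * (x ⬝ᵥ x) ≤ quadForm (S.Qt d t) x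
  exists_le_Bt : ∃ b : ℝ, 0 < b ∧
    ∀ t x, b * (x ⬝ᵥ x) ≤ quadForm (S.Bt d t * (S.Bt d t)ᵀ) x
  isUnit_At : ∀ t, IsUnit (S.At d t)
  bounded_At : UniformlyBounded (S.At d)
  bounded_inv_At : UniformlyBounded fun t => (S.At d t)⁻¹
  bounded_Bt : UniformlyBounded (S.Bt d)
  bounded_Qt : UniformlyBounded (S.Qt d)
  bounded_Rt : UniformlyBounded (S.Rt d)

namespace IsUniform

variable (h : S.IsUniform d)
include h

theorem posDef_Qt (t : ℕ) : (S.Qt d t).PosDef := by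
  obtain ⟨q, hq, hle⟩ := h.exists_le_Qt
  exact posDef_of_lower_bound (h.transpose_Qt t) hq (hle t)

theorem posDef_Bt (t : ℕ) : (S.Bt d t * (S.Bt d t)ᵀ).PosDef := by
  obtain ⟨b, hb, hle⟩ := h.exists_le_Bt
  exact posDef_of_lower_bound (by simp) hb (hle t)

theorem posDef_termX (j : ℕ) : (S.termX d j).PosDef :=
  posDef_deadbeatCost _ _ (h.posDef_Qt j) (h.posDef_Rt j)

theorem bounded_termX : UniformlyBounded (S.termX d) := by
  obtain ⟨b, hb, hle⟩ := h.exists_le_Bt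
  have hinv := UniformlyBounded.inv h.posDef_Bt hb hle
  exact h.bounded_Qt.add ((((((h.bounded_At.transpose.mul hinv).mul h.bounded_Bt).mul
    h.bounded_Rt).mul h.bounded_Bt.transpose).mul hinv).mul h.bounded_At)

theorem posDef_ricc (t : ℕ) {P : Matrix (Fin n) (Fin n) ℝ} (hP : P.PosSemidef) :
    (S.ricc d t P).PosDef :=
  posDef_riccMap _ _ (h.posDef_Qt t) (h.posDef_Rt t) hP

theorem posDef_riccComp {X : Matrix (Fin n) (Fin n) ℝ} (hX : X.PosDef) (t k : ℕ) :
    (S.riccComp d t k X).PosDef := by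
  induction k generalizing t with
  | zero => exact hX
  | succ k ih => exact h.posDef_ricc t (ih (t + 1)).posSemidef

theorem riccComp_mono {X Y : Matrix (Fin n) (Fin n) ℝ} (hX : X.PosDef) (hY : Y.PosDef)
    (hXY : ∀ x, quadForm X x ≤ quadForm Y x) (t k : ℕ) (x : Fin n → ℝ) :
    quadForm (S.riccComp d t k X) x ≤ quadForm (S.riccComp d t k Y) x := by
  induction k generalizing t x with
  | zero => exact hXY x
  | succ k ih =>
    exact riccMap_mono _ _ (h.posDef_Qt t) (h.posDef_Rt t)
      (h.posDef_riccComp hX _ _).posSemidef (h.posDef_riccComp hY _ _).posSemidef (ih (t + 1)) x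

omit h in
theorem riccComp_succ_right (S : LQRData n m) (d t k : ℕ) (X : Matrix (Fin n) (Fin n) ℝ) :
    S.riccComp d t (k + 1) X = S.riccComp d t k (S.ricc d (t + k) X) := by
  induction k generalizing t with
  | zero => rfl
  | succ k ih =>
    rw [riccComp, ih (t + 1), riccComp, Nat.add_right_comm t 1 k, Nat.add_assoc]

/-- With the deadbeat costs as terminal penalties, the value functions decrease with the
horizon. -/
theorem riccComp_termX_succ_le (t k : ℕ) (x : Fin n → ℝ) :
    quadForm (S.riccComp d t (k + 1) (S.termX d (t + k + 1))) x ≤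
      quadForm (S.riccComp d t k (S.termX d (t + k))) x := by
  rw [riccComp_succ_right]
  exact h.riccComp_mono (h.posDef_ricc _ (h.posDef_termX _).posSemidef) (h.posDef_termX _)
    (riccMap_le_deadbeatCost _ (h.posDef_Bt _) _ (h.posDef_Rt _) (h.posDef_termX _).posSemidef) t k x

theorem riccComp_termX_le (t k : ℕ) (x : Fin n → ℝ) :
    quadForm (S.riccComp d t k (S.termX d (t + k))) x ≤ quadForm (S.termX d t) x := by
  induction k with
  | zero => exact le_rfl
  | succ k ih => exact (h.riccComp_termX_succ_le t k x).trans ih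

/-! ### The constants of the contraction -/

theorem zetaAt_bddAbove : BddAbove (Set.range (S.zetaAt d)) := by
  obtain ⟨q, hq, hle⟩ := h.exists_le_Qt
  refine UniformlyBounded.norm2_le (UniformlyBounded.inv
    (M := fun t => zetaMat (S.At d t) (S.Bt d t) (S.Qt d t) (S.Rt d t))
    (fun t => posDef_zetaMat _ _ (h.posDef_Qt t) (h.posDef_Rt t)) hq fun t x => ?_)
  have h1 := (h.posDef_Rt t).inv.posSemidef.conjTranspose_mul_mul_same
    ((S.Bt d t)ᵀ * ((S.At d t)ᵀ)⁻¹ * S.Qt d t)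
  have e : ((S.Bt d t)ᵀ * ((S.At d t)ᵀ)⁻¹ * S.Qt d t)ᴴ * (S.Rt d t)⁻¹ *
      ((S.Bt d t)ᵀ * ((S.At d t)ᵀ)⁻¹ * S.Qt d t) =
      S.Qt d t * (S.At d t)⁻¹ * S.Bt d t * (S.Rt d t)⁻¹ * (S.Bt d t)ᵀ * ((S.At d t)ᵀ)⁻¹ *
        S.Qt d t := by
    rw [Matrix.conjTranspose_eq_transpose_of_trivial]
    simp only [Matrix.transpose_mul, Matrix.transpose_transpose, h.transpose_Qt,
      Matrix.transpose_nonsing_inv, Matrix.mul_assoc]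
  rw [e] at h1
  rw [zetaMat, quadForm_add]
  exact (hle t x).trans (le_add_of_nonneg_right ((posSemidef_iff.1 h1).2 x))

theorem inv_zetaMat_le (t : ℕ) (x : Fin n → ℝ) :
    quadForm (zetaMat (S.At d t) (S.Bt d t) (S.Qt d t) (S.Rt d t))⁻¹ x ≤
      S.zetaUp d * (x ⬝ᵥ x) :=
  (quadForm_le_norm2 _ x).trans (mul_le_mul_of_nonneg_right
    (le_ciSup (f := S.zetaAt d) h.zetaAt_bddAbove t) (dotProduct_self_nonneg' x))

theorem zetaUp_pos (hn : 0 < n) : 0 < S.zetaUp d := by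
  have h1 := h.inv_zetaMat_le 0 (Pi.single ⟨0, hn⟩ 1)
  have h2 := (posDef_iff.1 (posDef_zetaMat (S.At d 0) (S.Bt d 0) (h.posDef_Qt 0)
    (h.posDef_Rt 0)).inv).2 (Pi.single ⟨0, hn⟩ 1) (by simp)
  simp only [dotProduct_single_one, Pi.single_eq_same, mul_one] at h1
  exact h2.trans_le h1

theorem exists_le_epsMat : ∃ e : ℝ, 0 < e ∧ ∀ t x, e * (x ⬝ᵥ x) ≤
    quadForm (epsMat (S.At d t) (S.Bt d t) (S.Qt d t) (S.Rt d t)) x := by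
  obtain ⟨b, hb, hB⟩ := h.exists_le_Bt
  have hbd : UniformlyBounded fun t => S.Rt d t +
      (S.Bt d t)ᵀ * ((S.At d t)ᵀ)⁻¹ * S.Qt d t * (S.At d t)⁻¹ * S.Bt d t := by
    have h1 : UniformlyBounded fun t => ((S.At d t)ᵀ)⁻¹ := by
      simpa only [Matrix.transpose_nonsing_inv] using h.bounded_inv_At.transpose
    exact h.bounded_Rt.add ((((h.bounded_Bt.transpose.mul h1).mul h.bounded_Qt).mul
      h.bounded_inv_At).mul h.bounded_Bt)
  obtain ⟨c, hc, hC⟩ := hbd.quadForm_le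
  obtain ⟨a, ha, hA⟩ := h.bounded_At.transpose.mulVec_le
  refine ⟨c⁻¹ * (b * a⁻¹), by positivity, fun t x => ?_⟩
  have hM := posDef_epsHessian (S.At d t) (S.Bt d t) (h.posDef_Qt t) (h.posDef_Rt t)
  set y := ((S.At d t)ᵀ)⁻¹ *ᵥ x with hy
  have e1 : quadForm (epsMat (S.At d t) (S.Bt d t) (S.Qt d t) (S.Rt d t)) x =
      quadForm (S.Rt d t + (S.Bt d t)ᵀ * ((S.At d t)ᵀ)⁻¹ * S.Qt d t * (S.At d t)⁻¹ * S.Bt d t)⁻¹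
        ((S.Bt d t)ᵀ *ᵥ y) := by
    rw [hy, Matrix.mulVec_mulVec, ← quadForm_transpose_mul_mul]
    simp only [epsMat, Matrix.transpose_mul, Matrix.transpose_nonsing_inv,
      Matrix.transpose_transpose, Matrix.mul_assoc]
  have hdet : IsUnit (S.At d t)ᵀ.det := by
    rw [Matrix.det_transpose]
    exact (Matrix.isUnit_iff_isUnit_det _).1 (h.isUnit_At t)
  have e2 : (S.At d t)ᵀ *ᵥ y = x := by
    rw [hy, Matrix.mulVec_mulVec, Matrix.mul_nonsing_inv _ hdet, Matrix.one_mulVec]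
  have h1 := le_quadForm_inv_of_le hM hc (hC t) ((S.Bt d t)ᵀ *ᵥ y)
  have h2 := hB t y
  rw [quadForm_mul_transpose_self] at h2
  have h3 := hA t y
  rw [e2] at h3
  rw [e1]
  refine le_trans ?_ h1
  rw [mul_assoc, mul_assoc]
  refine mul_le_mul_of_nonneg_left (le_trans ?_ h2) (inv_pos.2 hc).le
  refine mul_le_mul_of_nonneg_left ?_ hb.le
  rwa [← div_eq_inv_mul, div_le_iff₀ ha, mul_comm]

theorem epsLow_pos (hn : 0 < n) : 0 < S.epsLow d := by
  obtain ⟨e, he, hE⟩ := h.exists_le_epsMat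
  exact he.trans_le (le_ciInf fun t => le_lambdaMin hn (hE t))

theorem le_epsMat (hn : 0 < n) (t : ℕ) (x : Fin n → ℝ) : S.epsLow d * (x ⬝ᵥ x) ≤
    quadForm (epsMat (S.At d t) (S.Bt d t) (S.Qt d t) (S.Rt d t)) x :=
  lambdaMin_of_iInf_pos (h.epsLow_pos hn) t x

/-! ### The bounded solution of the Riccati recursion -/

/-- The limit, as the horizon grows, of the value functions with deadbeat terminal penalty. -/
theorem exists_isBoundedRiccatiSolution : ∃ P, S.IsBoundedRiccatiSolution d P := by
  have hlim (t : ℕ) := exists_tendsto_of_antitone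
    (fun k => (h.posDef_riccComp (h.posDef_termX (t + k)) t k).posSemidef)
    (h.riccComp_termX_succ_le t)
  choose P hP hlim using hlim
  refine ⟨P, hP, ?_, fun t => ?_⟩
  · obtain ⟨c, hc, hX⟩ := h.bounded_termX.quadForm_le
    have hb : UniformlyBounded P := UniformlyBounded.of_quadForm_le hP fun t x =>
      le_of_tendsto' (((continuous_quadForm x).tendsto _).comp (hlim t))
        fun k => (h.riccComp_termX_le t k x).trans (hX t x)
    obtain ⟨M, hM⟩ := hb.norm2_le
    exact ⟨M, fun t => hM ⟨t, rfl⟩⟩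
  · refine tendsto_nhds_unique ((tendsto_add_atTop_iff_nat 1).2 (hlim t)) ?_
    refine (tendsto_riccMap (S.At d t) (S.Bt d t) (S.Qt d t) (h.posDef_Rt t) (hP (t + 1))
      (hlim (t + 1))).congr fun k => ?_
    rw [Nat.add_right_comm t 1 k]
    rfl

omit h in
theorem riccComp_solution {P : ℕ → Matrix (Fin n) (Fin n) ℝ}
    (hP : S.IsBoundedRiccatiSolution d P) (t k : ℕ) : S.riccComp d t k (P (t + k)) = P t := by
  induction k generalizing t with
  | zero => rfl
  | succ k ih =>
    rw [riccComp, show t + (k + 1) = t + 1 + k by omega, ih (t + 1), ← hP.2.2 t]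

theorem posDef_solution {P : ℕ → Matrix (Fin n) (Fin n) ℝ}
    (hP : S.IsBoundedRiccatiSolution d P) (t : ℕ) : (P t).PosDef := by
  rw [hP.2.2 t]
  exact h.posDef_ricc t (hP.1 (t + 1))

theorem Qt_le_solution {P : ℕ → Matrix (Fin n) (Fin n) ℝ}
    (hP : S.IsBoundedRiccatiSolution d P) (t : ℕ) (x : Fin n → ℝ) :
    quadForm (S.Qt d t) x ≤ quadForm (P t) x := by
  rw [hP.2.2 t]
  exact le_riccMap _ _ _ (h.posDef_Rt t) (hP.1 (t + 1)) x

theorem solution_lt_termX {P : ℕ → Matrix (Fin n) (Fin n) ℝ}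
    (hP : S.IsBoundedRiccatiSolution d P) (t : ℕ) {x : Fin n → ℝ} (hx : x ≠ 0) :
    quadForm (P t) x < quadForm (S.termX d t) x := by
  rw [hP.2.2 t]
  exact riccMap_lt_deadbeatCost (h.isUnit_At t) (h.posDef_Bt t) _ (h.posDef_Rt t)
    (hP.1 (t + 1)) hx

theorem solution_le_termX {P : ℕ → Matrix (Fin n) (Fin n) ℝ}
    (hP : S.IsBoundedRiccatiSolution d P) (t : ℕ) (x : Fin n → ℝ) :
    quadForm (P t) x ≤ quadForm (S.termX d t) x := by
  rw [hP.2.2 t]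
  exact riccMap_le_deadbeatCost _ (h.posDef_Bt t) _ (h.posDef_Rt t) (hP.1 (t + 1)) x

/-- Iterating the contraction along a solution of the Riccati recursion. -/
theorem riccComp_le_solution (hn : 0 < n) {P : ℕ → Matrix (Fin n) (Fin n) ℝ}
    (hP : S.IsBoundedRiccatiSolution d P) {X : Matrix (Fin n) (Fin n) ℝ} (hX : X.PosDef)
    {α : ℝ} (hα : 1 ≤ α) (t k : ℕ)
    (hle : ∀ x, quadForm X x ≤ α * quadForm (P (t + k)) x) (x : Fin n → ℝ) :
    quadForm (S.riccComp d t k X) x ≤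
      α ^ ((S.zetaUp d / (S.zetaUp d + S.epsLow d)) ^ k) * quadForm (P t) x := by
  have hζ := h.zetaUp_pos hn
  have hε := h.epsLow_pos hn
  induction k generalizing t x with
  | zero => simpa [riccComp] using hle x
  | succ k ih =>
    have h1 := ih (t + 1) (by rwa [Nat.add_right_comm t 1 k])
    have h2 := riccMap_contraction (S.Bt d t) (h.isUnit_At t) (h.posDef_Qt t) (h.posDef_Rt t)
      (h.posDef_riccComp hX (t + 1) k).posSemidef (h.posDef_solution hP (t + 1)) hζ hε
      (h.inv_zetaMat_le t) (h.le_epsMat hn t) (Real.one_le_rpow hα (by positivity)) h1 x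
    rw [← Real.rpow_mul (by linarith), ← pow_succ] at h2
    rw [hP.2.2 t]
    exact h2

theorem solution_le (hn : 0 < n) {P P' : ℕ → Matrix (Fin n) (Fin n) ℝ}
    (hP : S.IsBoundedRiccatiSolution d P) (hP' : S.IsBoundedRiccatiSolution d P') (t : ℕ)
    (x : Fin n → ℝ) : quadForm (P t) x ≤ quadForm (P' t) x := by
  obtain ⟨M, hM⟩ := hP.2.1
  obtain ⟨q, hq, hQ⟩ := h.exists_le_Qt
  have hζ := h.zetaUp_pos hn
  have hε := h.epsLow_pos hn
  set α := max 1 (M / q)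
  have hα : 1 ≤ α := le_max_left _ _
  have hM0 : 0 ≤ M := (norm2_nonneg _).trans (hM 0)
  have hle (s : ℕ) (y : Fin n → ℝ) : quadForm (P s) y ≤ α * quadForm (P' s) y := by
    have hy := dotProduct_self_nonneg' y
    calc quadForm (P s) y ≤ M * (y ⬝ᵥ y) :=
          (quadForm_le_norm2 _ y).trans (mul_le_mul_of_nonneg_right (hM s) hy)
      _ = M / q * (q * (y ⬝ᵥ y)) := by field_simp
      _ ≤ M / q * quadForm (P' s) y := mul_le_mul_of_nonneg_left
          ((hQ s y).trans (h.Qt_le_solution hP' s y)) (by positivity)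
      _ ≤ α * quadForm (P' s) y := mul_le_mul_of_nonneg_right (le_max_right _ _)
          ((posSemidef_iff.1 (hP'.1 s)).2 y)
  have hk (k : ℕ) := h.riccComp_le_solution hn hP' (h.posDef_solution hP (t + k)) hα t k
    (hle (t + k)) x
  simp only [riccComp_solution hP] at hk
  have hρ : Tendsto (fun k : ℕ => (S.zetaUp d / (S.zetaUp d + S.epsLow d)) ^ k) atTop (𝓝 0) :=
    tendsto_pow_atTop_nhds_zero_of_lt_one (by positivity)
      ((div_lt_one (by positivity)).2 (by linarith))
  have hlim := (((Real.continuous_const_rpow (by positivity : α ≠ 0)).tendsto 0).comp hρ).mul_const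
    (quadForm (P' t) x)
  rw [Real.rpow_zero, one_mul] at hlim
  exact ge_of_tendsto' hlim hk

theorem existsUnique_isBoundedRiccatiSolution (hn : 0 < n) :
    ∃! P, S.IsBoundedRiccatiSolution d P := by
  obtain ⟨P, hP⟩ := h.exists_isBoundedRiccatiSolution
  refine ⟨P, hP, fun P' hP' => funext fun t => ?_⟩
  exact eq_of_quadForm_eq (posSemidef_iff.1 (hP'.1 t)).1 (posSemidef_iff.1 (hP.1 t)).1
    fun x => le_antisymm (h.solution_le hn hP' hP t x) (h.solution_le hn hP hP' t x)

end IsUniform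

end LQRData

namespace LQRData

open LQR Filter Topology

variable {n m d : ℕ} {S : LQRData n m}

/-! ### Costs along trajectories -/

theorem costJ_succ (S : LQRData n m) (d T t : ℕ) (χ : Fin n → ℝ) (w : ℕ → Fin d × Fin m → ℝ) :
    S.costJ d (T + 1) t χ w = S.costJ d T t χ w +
      (quadForm (S.Qt d (t + T)) (S.traj d t χ w T) + quadForm (S.Rt d (t + T)) (w T)) :=
  Finset.sum_range_succ _ _

theorem traj_congr (S : LQRData n m) (d t : ℕ) (χ : Fin n → ℝ) {w w' : ℕ → Fin d × Fin m → ℝ}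
    {T : ℕ} (hw : ∀ i < T, w i = w' i) {i : ℕ} (hi : i ≤ T) :
    S.traj d t χ w i = S.traj d t χ w' i := by
  induction i with
  | zero => rfl
  | succ i ih => rw [traj, traj, ih (by omega), hw i (by omega)]

theorem traj_clInput (S : LQRData n m) (d : ℕ) (μ : ℕ → (Fin n → ℝ) → Fin d × Fin m → ℝ)
    (ξ : Fin n → ℝ) (i : ℕ) : S.traj d 0 ξ (S.clInput d μ ξ) i = S.clState d μ ξ i := by
  induction i with
  | zero => rfl
  | succ i ih => rw [traj, clState, ih, Nat.zero_add]; rfl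

namespace IsUniform

section

variable (h : S.IsUniform d)
include h

/-- The cost of an arbitrary input along a solution `X_i` of the Riccati recursion: the optimal
value plus the squared deviations from the optimal feedback. -/
theorem costJ_add_eq (T t : ℕ) (χ : Fin n → ℝ) (w : ℕ → Fin d × Fin m → ℝ)
    {X : ℕ → Matrix (Fin n) (Fin n) ℝ} (hX : ∀ i, (X i).PosSemidef)
    (hrec : ∀ i < T, X i = S.ricc d (t + i) (X (i + 1))) :
    S.costJ d T t χ w + quadForm (X T) (S.traj d t χ w T) = quadForm (X 0) χ +
      ∑ i ∈ Finset.range T,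
        quadForm (S.Rt d (t + i) + (S.Bt d (t + i))ᵀ * X (i + 1) * S.Bt d (t + i))
          (w i + S.gain d (t + i) (X (i + 1)) *ᵥ S.traj d t χ w i) := by
  induction T with
  | zero => simp [costJ, traj]
  | succ T ih =>
    have h1 := ih fun i hi => hrec i (by omega)
    have h2 : quadForm (S.Qt d (t + T)) (S.traj d t χ w T) + quadForm (S.Rt d (t + T)) (w T) +
        quadForm (X (T + 1)) (S.traj d t χ w (T + 1)) =
        quadForm (X T) (S.traj d t χ w T) +
        quadForm (S.Rt d (t + T) + (S.Bt d (t + T))ᵀ * X (T + 1) * S.Bt d (t + T))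
          (w T + S.gain d (t + T) (X (T + 1)) *ᵥ S.traj d t χ w T) := by
      rw [hrec T (by omega)]
      exact stage_cost_eq _ _ _ (h.posDef_Rt (t + T)) (hX (T + 1)) _ _
    rw [costJ_succ, Finset.sum_range_succ]
    linarith

theorem stage_nonneg (t : ℕ) (x : Fin n → ℝ) (u : Fin d × Fin m → ℝ) :
    0 ≤ quadForm (S.Qt d t) x + quadForm (S.Rt d t) u :=
  add_nonneg ((posSemidef_iff.1 (h.posDef_Qt t).posSemidef).2 x)
    ((posSemidef_iff.1 (h.posDef_Rt t).posSemidef).2 u)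

theorem exists_hasCost_of_le {ξ : Fin n → ℝ} {u : ℕ → Fin d × Fin m → ℝ} {c : ℝ}
    (hc : ∀ T, S.costJ d T 0 ξ u ≤ c) : ∃ J, S.HasCost d ξ u J := by
  refine ⟨_, tendsto_atTop_ciSup (monotone_nat_of_le_succ fun T => ?_)
    ⟨c, by rintro _ ⟨T, rfl⟩; exact hc T⟩⟩
  rw [costJ_succ]
  exact le_add_of_nonneg_right (h.stage_nonneg _ _ _)

/-- An input of finite cost drives the state to the origin. -/
theorem tendsto_traj_of_hasCost {ξ : Fin n → ℝ} {u : ℕ → Fin d × Fin m → ℝ} {c : ℝ}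
    (hc : S.HasCost d ξ u c) :
    Tendsto (fun T => S.traj d 0 ξ u T ⬝ᵥ S.traj d 0 ξ u T) atTop (𝓝 0) := by
  obtain ⟨q, hq, hQ⟩ := h.exists_le_Qt
  have h1 : Tendsto (fun T => S.costJ d (T + 1) 0 ξ u - S.costJ d T 0 ξ u) atTop (𝓝 0) := by
    have := ((tendsto_add_atTop_iff_nat 1).2 hc).sub hc
    rwa [sub_self] at this
  have h2 := h1.const_mul q⁻¹
  rw [mul_zero] at h2
  refine squeeze_zero (fun T => dotProduct_self_nonneg' _) (fun T => ?_) h2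
  rw [costJ_succ, add_sub_cancel_left, ← div_eq_inv_mul, le_div_iff₀ hq, mul_comm]
  exact (hQ (0 + T) _).trans
    (le_add_of_nonneg_right ((posSemidef_iff.1 (h.posDef_Rt _).posSemidef).2 _))

theorem tendsto_solution_of_hasCost {P : ℕ → Matrix (Fin n) (Fin n) ℝ}
    (hP : S.IsBoundedRiccatiSolution d P) {ξ : Fin n → ℝ} {u : ℕ → Fin d × Fin m → ℝ} {c : ℝ}
    (hc : S.HasCost d ξ u c) :
    Tendsto (fun T => quadForm (P T) (S.traj d 0 ξ u T)) atTop (𝓝 0) := by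
  obtain ⟨M, hM⟩ := hP.2.1
  have h1 := (h.tendsto_traj_of_hasCost hc).const_mul M
  rw [mul_zero] at h1
  exact squeeze_zero (fun T => (posSemidef_iff.1 (hP.1 T)).2 _)
    (fun T => (quadForm_le_norm2 _ _).trans
      (mul_le_mul_of_nonneg_right (hM T) (dotProduct_self_nonneg' _))) h1

theorem costJ_add_solution {P : ℕ → Matrix (Fin n) (Fin n) ℝ}
    (hP : S.IsBoundedRiccatiSolution d P) (ξ : Fin n → ℝ) (u : ℕ → Fin d × Fin m → ℝ) (T : ℕ) :
    S.costJ d T 0 ξ u + quadForm (P T) (S.traj d 0 ξ u T) = quadForm (P 0) ξ +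
      ∑ i ∈ Finset.range T,
        quadForm (S.Rt d i + (S.Bt d i)ᵀ * P (i + 1) * S.Bt d i)
          (u i + S.gain d i (P (i + 1)) *ᵥ S.traj d 0 ξ u i) := by
  have := h.costJ_add_eq T 0 ξ u hP.1 fun i _ => by rw [Nat.zero_add]; exact hP.2.2 i
  simpa only [Nat.zero_add] using this

theorem solution_le_of_hasCost {P : ℕ → Matrix (Fin n) (Fin n) ℝ}
    (hP : S.IsBoundedRiccatiSolution d P) {ξ : Fin n → ℝ} {u : ℕ → Fin d × Fin m → ℝ} {c : ℝ}
    (hc : S.HasCost d ξ u c) : quadForm (P 0) ξ ≤ c := by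
  have h1 := hc.add (h.tendsto_solution_of_hasCost hP hc)
  rw [add_zero] at h1
  refine ge_of_tendsto' h1 fun T => ?_
  rw [h.costJ_add_solution hP]
  exact le_add_of_nonneg_right (Finset.sum_nonneg fun i _ =>
    (posSemidef_iff.1 (posDef_hessian _ (h.posDef_Rt i) (hP.1 _)).posSemidef).2 _)

theorem hasCost_optPolicy {P : ℕ → Matrix (Fin n) (Fin n) ℝ}
    (hP : S.IsBoundedRiccatiSolution d P) (ξ : Fin n → ℝ) :
    S.HasCost d ξ (S.clInput d (S.optPolicy d P) ξ) (quadForm (P 0) ξ) := by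
  set u := S.clInput d (S.optPolicy d P) ξ with hu
  have heq (T : ℕ) : S.costJ d T 0 ξ u + quadForm (P T) (S.traj d 0 ξ u T) = quadForm (P 0) ξ := by
    rw [h.costJ_add_solution hP, add_eq_left]
    refine Finset.sum_eq_zero fun i _ => ?_
    have : u i = -(S.gain d i (P (i + 1)) *ᵥ S.traj d 0 ξ u i) := by
      rw [hu, traj_clInput]; rfl
    rw [this, neg_add_cancel, quadForm_zero_vec]
  obtain ⟨J, hJ⟩ := h.exists_hasCost_of_le (ξ := ξ) (u := u) (c := quadForm (P 0) ξ) fun T => by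
    have h1 := heq T
    have h2 := (posSemidef_iff.1 (hP.1 T)).2 (S.traj d 0 ξ u T)
    linarith
  have h1 := hJ.add (h.tendsto_solution_of_hasCost hP hJ)
  rw [add_zero] at h1
  have h2 := tendsto_nhds_unique h1 (tendsto_const_nhds.congr fun T => (heq T).symm)
  rwa [h2] at hJ

/-! ### The receding-horizon policy -/

theorem posDef_hatXsucc (T t : ℕ) : (S.hatXsucc d T t).PosDef :=
  h.posDef_riccComp (h.posDef_termX _) _ _

/-- By dynamic programming, the minimizers of the finite-horizon cost with terminal penalty `X`
are the inputs generated by the feedback gains of the Riccati recursion that ends in `X`. -/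
theorem isMinimizer_first_eq {T : ℕ} (hT : 0 < T) (t : ℕ) (χ : Fin n → ℝ)
    {X : Matrix (Fin n) (Fin n) ℝ} (hX : X.PosDef) :
    (∃ w : Fin T → Fin d × Fin m → ℝ,
      (∀ w', S.costL d T t χ w X ≤ S.costL d T t χ w' X) ∧
        pad w 0 = -(S.gain d t (S.riccComp d (t + 1) (T - 1) X) *ᵥ χ)) ∧
    ∀ w : Fin T → Fin d × Fin m → ℝ, (∀ w', S.costL d T t χ w X ≤ S.costL d T t χ w' X) →
      pad w 0 = -(S.gain d t (S.riccComp d (t + 1) (T - 1) X) *ᵥ χ) := by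
  set Y : ℕ → Matrix (Fin n) (Fin n) ℝ := fun i => S.riccComp d (t + i) (T - i) X with hY
  have hYpos (i : ℕ) : (Y i).PosSemidef := (h.posDef_riccComp hX _ _).posSemidef
  have hrec : ∀ i < T, Y i = S.ricc d (t + i) (Y (i + 1)) := by
    intro i hi
    rw [hY]
    change S.riccComp d (t + i) (T - i) X = _
    rw [show T - i = (T - (i + 1)) + 1 by omega]
    rfl
  have hYT : Y T = X := by
    rw [hY]
    change S.riccComp d (t + T) (T - T) X = _
    rw [Nat.sub_self]
    rfl
  have hcost (w : Fin T → Fin d × Fin m → ℝ) : S.costL d T t χ w X = quadForm (Y 0) χ +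
      ∑ i ∈ Finset.range T,
        quadForm (S.Rt d (t + i) + (S.Bt d (t + i))ᵀ * Y (i + 1) * S.Bt d (t + i))
          (pad w i + S.gain d (t + i) (Y (i + 1)) *ᵥ S.traj d t χ (pad w) i) := by
    rw [← h.costJ_add_eq T t χ (pad w) hYpos hrec, hYT]
    rfl
  have hsq (i : ℕ) := posDef_hessian (S.Bt d (t + i)) (h.posDef_Rt (t + i)) (hYpos (i + 1))
  -- the state trajectory under the optimal feedback
  let z : ℕ → Fin n → ℝ := fun i => Nat.rec χ (fun j y => S.At d (t + j) *ᵥ y +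
    S.Bt d (t + j) *ᵥ (-(S.gain d (t + j) (Y (j + 1)) *ᵥ y))) i
  let u : ℕ → Fin d × Fin m → ℝ := fun i => -(S.gain d (t + i) (Y (i + 1)) *ᵥ z i)
  let w₀ : Fin T → Fin d × Fin m → ℝ := fun i => u i
  have hpad : ∀ i < T, pad w₀ i = u i := fun i hi => by rw [pad, dif_pos hi]
  have hz (i : ℕ) : S.traj d t χ u i = z i := by
    induction i with
    | zero => rfl
    | succ i ih => rw [traj, ih]
  have hw₀ : S.costL d T t χ w₀ X = quadForm (Y 0) χ := by
    rw [hcost, add_eq_left]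
    refine Finset.sum_eq_zero fun i hi => ?_
    have hi' := Finset.mem_range.1 hi
    rw [traj_congr S d t χ hpad hi'.le, hpad i hi', hz, neg_add_cancel, quadForm_zero_vec]
  have hmin (w : Fin T → Fin d × Fin m → ℝ) : quadForm (Y 0) χ ≤ S.costL d T t χ w X := by
    rw [hcost]
    exact le_add_of_nonneg_right (Finset.sum_nonneg fun i _ =>
      (posSemidef_iff.1 (hsq i).posSemidef).2 _)
  refine ⟨⟨w₀, fun w' => hw₀.trans_le (hmin w'), hpad 0 hT⟩, fun w hw => ?_⟩
  have h1 := (hw w₀).trans_eq hw₀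
  rw [hcost, add_le_iff_nonpos_right] at h1
  have h2 := (Finset.single_le_sum (fun i _ => (posSemidef_iff.1 (hsq i).posSemidef).2 _)
    (Finset.mem_range.2 hT)).trans h1
  by_contra hne
  refine absurd h2 (not_le.2 ((posDef_iff.1 (hsq 0)).2 _ fun h0 => hne ?_))
  exact eq_neg_of_add_eq_zero_left h0

theorem isRecedingHorizonPolicy_iff {T : ℕ} (hT : 0 < T)
    (μ : ℕ → (Fin n → ℝ) → Fin d × Fin m → ℝ) :
    S.IsRecedingHorizonPolicy d T μ ↔
      μ = fun t χ => -(S.gain d t (S.hatXsucc d T t) *ᵥ χ) := by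
  constructor
  · intro hμ
    funext t χ
    obtain ⟨w, hw, hw0⟩ := hμ t χ
    rw [hw0]
    exact (h.isMinimizer_first_eq hT t χ (h.posDef_termX (t + T))).2 w hw
  · rintro rfl t χ
    obtain ⟨w, hw, hw0⟩ := (h.isMinimizer_first_eq hT t χ (h.posDef_termX (t + T))).1
    exact ⟨w, hw, hw0.symm⟩

/-- The value functions of the receding-horizon problems decrease along the closed loop, because
the terminal penalty dominates its own Riccati image. -/
theorem ricc_hatXsucc_le {T : ℕ} (hT : 0 < T) (t : ℕ) (x : Fin n → ℝ) :
    quadForm (S.ricc d (t + 1) (S.hatXsucc d T (t + 1))) x ≤ quadForm (S.hatXsucc d T t) x := by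
  have h1 := h.riccComp_termX_succ_le (t + 1) (T - 1) x
  have e1 : t + 1 + (T - 1) = t + T := by omega
  have e2 : t + T + 1 = t + 1 + T := by omega
  rw [e1, e2] at h1
  exact h1

theorem solution_le_hatXsucc {P : ℕ → Matrix (Fin n) (Fin n) ℝ}
    (hP : S.IsBoundedRiccatiSolution d P) {T : ℕ} (hT : 0 < T) (t : ℕ) (x : Fin n → ℝ) :
    quadForm (P (t + 1)) x ≤ quadForm (S.hatXsucc d T t) x := by
  have h1 := h.riccComp_mono (h.posDef_solution hP (t + T)) (h.posDef_termX (t + T))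
    (h.solution_le_termX hP (t + T)) (t + 1) (T - 1) x
  rw [show t + T = t + 1 + (T - 1) by omega, riccComp_solution hP,
    show t + 1 + (T - 1) = t + T by omega] at h1
  exact h1

/-! ### Positivity and finiteness of the constants -/

theorem bounded_ricc_hatXsucc {T : ℕ} (hT : 0 < T) :
    UniformlyBounded fun t => S.ricc d t (S.hatXsucc d T t) := by
  obtain ⟨c, hc, hX⟩ := h.bounded_termX.quadForm_le
  refine UniformlyBounded.of_quadForm_le
    (fun t => (h.posDef_ricc t (h.posDef_hatXsucc T t).posSemidef).posSemidef) (c := c)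
    fun t x => ?_
  have h1 := h.riccComp_termX_le t T x
  rw [show T = (T - 1) + 1 by omega] at h1
  have h2 := h1.trans (hX t x)
  rw [show T - 1 + 1 = T by omega] at h2
  refine le_trans (le_of_eq ?_) h2
  obtain ⟨T, rfl⟩ : ∃ k, T = k + 1 := ⟨T - 1, by omega⟩
  rfl

theorem omegaUpAt_bddAbove {T : ℕ} (hT : 0 < T) : BddAbove (Set.range (S.omegaUpAt d T)) :=
  (h.bounded_ricc_hatXsucc hT).norm2_le

theorem ricc_hatXsucc_le_omegaUp {T : ℕ} (hT : 0 < T) (t : ℕ) (x : Fin n → ℝ) :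
    quadForm (S.ricc d t (S.hatXsucc d T t)) x ≤ S.omegaUp d T * (x ⬝ᵥ x) :=
  (quadForm_le_norm2 _ x).trans (mul_le_mul_of_nonneg_right
    (le_ciSup (h.omegaUpAt_bddAbove hT) t) (dotProduct_self_nonneg' x))

theorem omegaLow_pos (hn : 0 < n) (T : ℕ) : 0 < S.omegaLow d T := by
  obtain ⟨q, hq, hQ⟩ := h.exists_le_Qt
  exact hq.trans_le (le_ciInf fun t => le_lambdaMin hn fun x => (hQ t x).trans
    (le_riccMap _ _ _ (h.posDef_Rt t) (h.posDef_hatXsucc T t).posSemidef x))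

theorem omegaLow_le (hn : 0 < n) (T t : ℕ) (x : Fin n → ℝ) :
    S.omegaLow d T * (x ⬝ᵥ x) ≤ quadForm (S.ricc d t (S.hatXsucc d T t)) x :=
  lambdaMin_of_iInf_pos (h.omegaLow_pos hn T) t x

theorem omegaLow_le_omegaUp (hn : 0 < n) {T : ℕ} (hT : 0 < T) :
    S.omegaLow d T ≤ S.omegaUp d T := by
  have h1 := (h.omegaLow_le hn T 0 (Pi.single ⟨0, hn⟩ 1)).trans
    (h.ricc_hatXsucc_le_omegaUp hT 0 (Pi.single ⟨0, hn⟩ 1))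
  simpa using h1

theorem lambdaLow_pos (hn : 0 < n) (T : ℕ) : 0 < S.lambdaLow d T := by
  obtain ⟨q, hq, hQ⟩ := h.exists_le_Qt
  refine hq.trans_le (le_ciInf fun t => le_lambdaMin hn fun x => (hQ t x).trans ?_)
  rw [quadForm_add, quadForm_transpose_mul_mul]
  exact le_add_of_nonneg_right ((posSemidef_iff.1 (h.posDef_Rt t).posSemidef).2 _)

theorem lambdaLow_le (hn : 0 < n) (T t : ℕ) (x : Fin n → ℝ) :
    S.lambdaLow d T * (x ⬝ᵥ x) ≤ quadForm (S.Qt d t) x +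
      quadForm (S.Rt d t) (-(S.gain d t (S.hatXsucc d T t) *ᵥ x)) := by
  have h1 := lambdaMin_of_iInf_pos (h.lambdaLow_pos hn T) t x
  rw [quadForm_add, quadForm_transpose_mul_mul] at h1
  rwa [quadForm_neg_vec]

end

section Solution

variable (h : S.IsUniform d) {P : ℕ → Matrix (Fin n) (Fin n) ℝ}
  (hP : S.IsBoundedRiccatiSolution d P)
include h hP

omit h in
theorem norm2_solution_bddAbove : BddAbove (Set.range fun t => norm2 (P t)) := by
  obtain ⟨M, hM⟩ := hP.2.1
  exact ⟨M, by rintro _ ⟨t, rfl⟩; exact hM t⟩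

omit h in
theorem solution_le_lambdaUp (t : ℕ) (x : Fin n → ℝ) :
    quadForm (P t) x ≤ lambdaUp P * (x ⬝ᵥ x) :=
  (quadForm_le_norm2 _ x).trans (mul_le_mul_of_nonneg_right
    (le_ciSup (norm2_solution_bddAbove hP) t) (dotProduct_self_nonneg' x))

theorem lambdaUp_pos (hn : 0 < n) : 0 < lambdaUp P := by
  have h1 := solution_le_lambdaUp hP 0 (Pi.single ⟨0, hn⟩ 1)
  have h2 := (posDef_iff.1 (h.posDef_solution hP 0)).2 (Pi.single ⟨0, hn⟩ 1) (by simp)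
  simp only [dotProduct_single_one, Pi.single_eq_same, mul_one] at h1
  exact h2.trans_le h1

theorem exists_le_lambdaMin_solution (hn : 0 < n) :
    ∃ q : ℝ, 0 < q ∧ ∀ t, q ≤ lambdaMin (P t) := by
  obtain ⟨q, hq, hQ⟩ := h.exists_le_Qt
  exact ⟨q, hq, fun t => le_lambdaMin hn fun x => (hQ t x).trans (h.Qt_le_solution hP t x)⟩

theorem deltaRatioAt_bddAbove (hn : 0 < n) (T : ℕ) :
    BddAbove (Set.range (S.deltaRatioAt d P T)) := by
  obtain ⟨q, hq, hQ⟩ := h.exists_le_lambdaMin_solution hP hn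
  obtain ⟨c, hc⟩ := h.bounded_termX.norm2_le
  refine ⟨c / q, ?_⟩
  rintro _ ⟨t, rfl⟩
  have hc' : norm2 (S.termX d (t + T)) ≤ c := hc ⟨t + T, rfl⟩
  exact div_le_div₀ ((norm2_nonneg _).trans hc') hc' hq (hQ _)

theorem termX_le_mul_solution (hn : 0 < n) (T t : ℕ) (x : Fin n → ℝ) :
    quadForm (S.termX d (t + T)) x ≤
      (⨆ t, S.deltaRatioAt d P T t) * quadForm (P (t + T)) x := by
  obtain ⟨q, hq, hQ⟩ := h.exists_le_lambdaMin_solution hP hn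
  have hpos : 0 < lambdaMin (P (t + T)) := hq.trans_le (hQ _)
  have h1 : S.deltaRatioAt d P T t ≤ ⨆ t, S.deltaRatioAt d P T t :=
    le_ciSup (h.deltaRatioAt_bddAbove hP hn T) t
  calc quadForm (S.termX d (t + T)) x ≤ norm2 (S.termX d (t + T)) * (x ⬝ᵥ x) :=
        quadForm_le_norm2 _ x
    _ = S.deltaRatioAt d P T t * (lambdaMin (P (t + T)) * (x ⬝ᵥ x)) := by
        rw [deltaRatioAt]; field_simp
    _ ≤ S.deltaRatioAt d P T t * quadForm (P (t + T)) x :=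
        mul_le_mul_of_nonneg_left (lambdaMin_mul_le hpos x)
          (div_nonneg (norm2_nonneg _) hpos.le)
    _ ≤ _ := mul_le_mul_of_nonneg_right h1 ((posSemidef_iff.1 (hP.1 _)).2 x)

/-- The deadbeat cost is strictly larger than the optimal cost, so that the ratio exceeds `1`. -/
theorem one_lt_iSup_deltaRatioAt (hn : 0 < n) (T : ℕ) : 1 < ⨆ t, S.deltaRatioAt d P T t := by
  have hx : (Pi.single ⟨0, hn⟩ 1 : Fin n → ℝ) ≠ 0 := by simp
  have h1 := h.solution_lt_termX hP (0 + T) hx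
  have h2 := h.termX_le_mul_solution hP hn T 0 (Pi.single ⟨0, hn⟩ 1)
  have h3 := (posDef_iff.1 (h.posDef_solution hP (0 + T))).2 _ hx
  have h4 := h1.trans_le h2
  by_contra hle
  have := mul_le_mul_of_nonneg_right (not_lt.1 hle) h3.le
  linarith

/-- The performance loss of the receding-horizon policy, in terms of the ratio `c` between the
finite-horizon value functions `X̂_{t+1}` and the optimal ones `P_{t+1}`. -/
theorem recedingHorizon_loss_le (hn : 0 < n) {T : ℕ} (hT : 0 < T)
    {μ : ℕ → (Fin n → ℝ) → Fin d × Fin m → ℝ} (hμ : S.IsRecedingHorizonPolicy d T μ) {c : ℝ}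
    (hc : 1 ≤ c)
    (hle : ∀ t x, quadForm (S.hatXsucc d T t) x ≤ c * quadForm (P (t + 1)) x) (ξ : Fin n → ℝ) :
    ∃ J, S.HasCost d ξ (S.clInput d μ ξ) J ∧ J - quadForm (P 0) ξ ≤
      (c - 1) * lambdaUp P * (S.omegaUp d T / S.lambdaLow d T) * (ξ ⬝ᵥ ξ) := by
  rw [h.isRecedingHorizonPolicy_iff hT] at hμ
  set u := S.clInput d μ ξ with hu
  set x := S.traj d 0 ξ u with hx
  have hui (i : ℕ) : u i = -(S.gain d i (S.hatXsucc d T i) *ᵥ x i) := by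
    rw [hx, hu, traj_clInput, clInput, hμ]
  have hxs (i : ℕ) : x (i + 1) = S.At d i *ᵥ x i + S.Bt d i *ᵥ u i := by
    rw [hx, traj, Nat.zero_add]
  have hXpos (i : ℕ) := (h.posDef_hatXsucc T i).posSemidef
  -- dynamic programming identity for the first stage of the horizon
  have hDP (i : ℕ) : quadForm (S.ricc d i (S.hatXsucc d T i)) (x i) =
      quadForm (S.Qt d i) (x i) + quadForm (S.Rt d i) (u i) +
        quadForm (S.hatXsucc d T i) (x (i + 1)) := by
    rw [hxs, hui]
    exact riccMap_eq_stage_cost _ _ _ (h.posDef_Rt i) (hXpos i) (x i)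
  have hsucc (N : ℕ) : S.costJ d (N + 1) 0 ξ u = S.costJ d N 0 ξ u +
      (quadForm (S.Qt d N) (x N) + quadForm (S.Rt d N) (u N)) := by
    rw [costJ_succ, Nat.zero_add]
  have hbound (N : ℕ) : S.costJ d N 0 ξ u +
      quadForm (S.ricc d N (S.hatXsucc d T N)) (x N) ≤
        quadForm (S.ricc d 0 (S.hatXsucc d T 0)) ξ := by
    induction N with
    | zero => simp [costJ, hx, traj]
    | succ N ih =>
      have h1 := h.ricc_hatXsucc_le hT N (x (N + 1))
      have h2 := hDP N
      have h3 := hsucc N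
      linarith
  have hcost (N : ℕ) : S.costJ d N 0 ξ u ≤ S.omegaUp d T * (ξ ⬝ᵥ ξ) := by
    have h1 := hbound N
    have h2 := (posSemidef_iff.1 (h.posDef_ricc N (hXpos N)).posSemidef).2 (x N)
    have h3 := h.ricc_hatXsucc_le_omegaUp hT 0 ξ
    linarith
  have hlow := h.lambdaLow_pos hn T
  have hstate (N : ℕ) : S.lambdaLow d T * ∑ i ∈ Finset.range N, x i ⬝ᵥ x i ≤
      S.costJ d N 0 ξ u := by
    induction N with
    | zero => simp [costJ]
    | succ N ih =>
      have h1 := h.lambdaLow_le hn T N (x N)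
      rw [← hui] at h1
      rw [hsucc, Finset.sum_range_succ, mul_add]
      linarith
  have hloss (N : ℕ) : S.costJ d N 0 ξ u + quadForm (P N) (x N) - quadForm (P 0) ξ ≤
      (c - 1) * lambdaUp P * ∑ i ∈ Finset.range N, x i ⬝ᵥ x i := by
    induction N with
    | zero => simp [costJ, hx, traj]
    | succ N ih =>
      have h1 := hDP N
      have h2 := h.solution_le_hatXsucc hP hT N (x (N + 1))
      have h3 := riccMap_le_mul (S.At d N) (S.Bt d N) (h.posDef_Qt N) (h.posDef_Rt N) (hXpos N)
        (hP.1 (N + 1)) hc (hle N) (x N)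
      have h4 : riccMap (S.At d N) (S.Bt d N) (S.Qt d N) (S.Rt d N) (P (N + 1)) = P N :=
        (hP.2.2 N).symm
      have h5 : riccMap (S.At d N) (S.Bt d N) (S.Qt d N) (S.Rt d N) (S.hatXsucc d T N) =
        S.ricc d N (S.hatXsucc d T N) := rfl
      rw [h4, h5] at h3
      have h6 := mul_le_mul_of_nonneg_left (solution_le_lambdaUp hP N (x N)) (sub_nonneg.2 hc)
      rw [hsucc, Finset.sum_range_succ, mul_add]
      linarith
  obtain ⟨J, hJ⟩ := h.exists_hasCost_of_le hcost
  refine ⟨J, hJ, ?_⟩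
  have hlim := (hJ.add (h.tendsto_solution_of_hasCost hP hJ)).sub_const (quadForm (P 0) ξ)
  rw [add_zero] at hlim
  refine le_of_tendsto' hlim fun N => (hloss N).trans ?_
  rw [mul_assoc _ (S.omegaUp d T / S.lambdaLow d T)]
  refine mul_le_mul_of_nonneg_left ?_ (mul_nonneg (sub_nonneg.2 hc) (h.lambdaUp_pos hP hn).le)
  rw [div_mul_eq_mul_div, le_div_iff₀ hlow, mul_comm]
  exact (hstate N).trans (hcost N)

theorem hatXsucc_le_mul_solution (hn : 0 < n) {T : ℕ} (hT : 0 < T) (t : ℕ) (x : Fin n → ℝ) :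
    quadForm (S.hatXsucc d T t) x ≤
      (⨆ t, S.deltaRatioAt d P T t) ^ ((S.zetaUp d / (S.zetaUp d + S.epsLow d)) ^ (T - 1)) *
        quadForm (P (t + 1)) x := by
  have e : t + 1 + (T - 1) = t + T := by omega
  exact h.riccComp_le_solution hn hP (h.posDef_termX (t + T))
    (h.one_lt_iSup_deltaRatioAt hP hn T).le (t + 1) (T - 1)
    (fun x => by rw [e]; exact h.termX_le_mul_solution hP hn T t x) x

end Solution

end IsUniform

/-- The condition on the horizon `T`, solved for the contraction factor `ρ ^ (T - 1)`. -/
theorem rpow_pow_le_of_horizon {n T : ℕ} (hn : 0 < n) (hT : 0 < T) {ρ α y : ℝ} (hρ0 : 0 < ρ)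
    (hρ1 : ρ < 1) (hα : 1 < α) (hy : 0 < y)
    (h : Real.log (Real.log ((y + 1) ^ (1 / (√(n : ℝ) * Real.log α)))) / Real.log ρ + 1 ≤ T) :
    α ^ (ρ ^ (T - 1)) ≤ y + 1 := by
  have hn1 : 1 ≤ √(n : ℝ) := Real.one_le_sqrt.2 (by exact_mod_cast hn)
  have hlog : 0 < Real.log α := Real.log_pos hα
  have hδ : 0 < √(n : ℝ) * Real.log α := by positivity
  have hly : 0 < Real.log (y + 1) := Real.log_pos (by linarith)
  have hlρ : Real.log ρ < 0 := Real.log_neg hρ0 hρ1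
  have hT1 : ((T - 1 : ℕ) : ℝ) = T - 1 := by rw [Nat.cast_sub hT, Nat.cast_one]
  rw [Real.log_rpow (by linarith), one_div, ← div_eq_inv_mul] at h
  set v := Real.log (y + 1) / (√(n : ℝ) * Real.log α) with hv
  have hv0 : 0 < v := by positivity
  have h1 : Real.log v / Real.log ρ ≤ ((T - 1 : ℕ) : ℝ) := by rw [hT1]; linarith
  rw [div_le_iff_of_neg hlρ, ← Real.log_pow] at h1
  have h2 : ρ ^ (T - 1) ≤ v := (Real.log_le_log_iff (by positivity) hv0).1 h1
  rw [hv, le_div_iff₀ hδ] at h2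
  rw [← Real.log_le_log_iff (by positivity) (by linarith), Real.log_rpow (by linarith)]
  refine le_trans ?_ h2
  refine mul_le_mul_of_nonneg_left ?_ (by positivity)
  exact le_mul_of_one_le_left hlog.le hn1

end LQRData

/-! ### Determinants -/

namespace LQR

variable {ι κ : Type*} [Fintype ι] [Fintype κ] [DecidableEq ι] [DecidableEq κ]

theorem one_le_det_one_add {M : Matrix ι ι ℝ} (hM : M.PosSemidef) : 1 ≤ (1 + M).det := by
  have hH : (1 + M).IsHermitian := Matrix.isHermitian_one.add hM.1
  rw [hH.det_eq_prod_eigenvalues]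
  rw [← Finset.prod_const_one (s := Finset.univ (α := ι))]
  refine Finset.prod_le_prod (fun _ _ => zero_le_one) fun i _ => ?_
  change 1 ≤ hH.eigenvalues i
  set v := hH.eigenvectorBasis i with hv
  have h1 : hH.eigenvalues i = quadForm (1 + M) v.ofLp := hH.eigenvalues_eq i
  have h2 : v.ofLp ⬝ᵥ v.ofLp = 1 := by
    rw [← norm_toLp_sq, WithLp.toLp_ofLp, hv, hH.eigenvectorBasis.orthonormal.1 i, one_pow]
  rw [h1, quadForm_add, quadForm_one, h2]
  exact le_add_of_nonneg_right ((posSemidef_iff.1 hM).2 _)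

theorem det_le_det_add_transpose_mul_self {R : Matrix ι ι ℝ} (hR : R.PosDef) (V : Matrix κ ι ℝ) :
    R.det ≤ (R + Vᵀ * V).det := by
  have hpsd : (V * R⁻¹ * Vᵀ).PosSemidef := by
    have := hR.inv.posSemidef.mul_mul_conjTranspose_same V
    rwa [Matrix.conjTranspose_eq_transpose_of_trivial] at this
  rw [Matrix.det_add_mul Vᵀ V ((Matrix.isUnit_iff_isUnit_det _).1 hR.isUnit)]
  exact le_mul_of_one_le_right hR.det_pos.le (one_le_det_one_add hpsd)

/-- The two Schur complements of the block matrix with rows `[R, Z]` and `[G, F]`. -/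
theorem det_sub_mul_inv_mul {R : Matrix κ κ ℝ} {F : Matrix ι ι ℝ} (hR : IsUnit R.det)
    (hF : IsUnit F.det) (G : Matrix ι κ ℝ) (Z : Matrix κ ι ℝ) :
    R.det * (F - G * R⁻¹ * Z).det = F.det * (R - Z * F⁻¹ * G).det := by
  let _ := Matrix.invertibleOfIsUnitDet R hR
  let _ := Matrix.invertibleOfIsUnitDet F hF
  have h1 := Matrix.det_fromBlocks₁₁ R Z G F
  rw [Matrix.det_fromBlocks₂₂, Matrix.invOf_eq_nonsing_inv, Matrix.invOf_eq_nonsing_inv] at h1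
  exact h1.symm

omit [DecidableEq ι] in
theorem UniformlyBounded.of_mulVec_le {M : ℕ → Matrix ι κ ℝ} {c : ℝ}
    (h : ∀ t x, (M t *ᵥ x) ⬝ᵥ (M t *ᵥ x) ≤ c * (x ⬝ᵥ x)) : UniformlyBounded M := by
  refine ⟨√c, fun t i j => Real.abs_le_sqrt ?_⟩
  have h1 := h t (Pi.single j 1)
  simp only [Matrix.mulVec_single_one, dotProduct_single_one, Pi.single_eq_same, mul_one] at h1
  refine le_trans ?_ h1
  have := Finset.single_le_sum (f := fun i => (M t).col j i * (M t).col j i)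
    (fun i _ => mul_self_nonneg _) (Finset.mem_univ i)
  simpa [dotProduct, sq] using this

theorem transpose_psdSqrt {n : ℕ} (M : Matrix (Fin n) (Fin n) ℝ) : (psdSqrt M)ᵀ = psdSqrt M := by
  open scoped MatrixOrder in
  have h := (Matrix.nonneg_iff_posSemidef.1 (CFC.sqrt_nonneg M)).1
  rwa [Matrix.IsHermitian, Matrix.conjTranspose_eq_transpose_of_trivial] at h

theorem psdSqrt_mul_self {n : ℕ} {M : Matrix (Fin n) (Fin n) ℝ} (hM : M.PosSemidef) :
    psdSqrt M * psdSqrt M = M := by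
  open scoped MatrixOrder in
  exact CFC.sqrt_mul_sqrt_self M (Matrix.nonneg_iff_posSemidef.2 hM)

end LQR

namespace LQRData

open LQR

variable {n m : ℕ} (S : LQRData n m) (d : ℕ)

/-! ### The lifted system -/

theorem theta_add (k i j : ℕ) : S.Theta k (i + j) = S.Theta (k + i) j * S.Theta k i := by
  induction j with
  | zero => simp [Theta]
  | succ j ih => rw [← Nat.add_assoc, Theta, ih, Theta, Matrix.mul_assoc, Nat.add_assoc]

variable {S} in
theorem isUnit_theta (hA : ∀ k, IsUnit (S.A k)) (k j : ℕ) : IsUnit (S.Theta k j) := by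
  induction j with
  | zero => exact isUnit_one
  | succ j ih => exact (hA _).mul ih

/-- The inverse of `Â_t`: the block lower triangular matrix of the transition matrices. -/
def transitionMatrix (t : ℕ) : Matrix (Fin (d + 1) × Fin n) (Fin (d + 1) × Fin n) ℝ :=
  Matrix.of fun p q => if q.1 ≤ p.1 then S.Theta (d * t + q.1) (p.1 - q.1) p.2 q.2 else 0

theorem hatA_mul_transitionMatrix (t : ℕ) : S.hatA d t * S.transitionMatrix d t = 1 := by
  rw [hatA, Matrix.sub_mul, Matrix.one_mul]
  ext ⟨p, a⟩ ⟨r, c⟩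
  rw [Matrix.sub_apply, Matrix.mul_apply, Fintype.sum_prod_type]
  simp only [Matrix.of_apply, transitionMatrix]
  have hone : (1 : Matrix (Fin (d + 1) × Fin n) (Fin (d + 1) × Fin n) ℝ) (p, a) (r, c) =
      if p = r then (1 : Matrix (Fin n) (Fin n) ℝ) a c else 0 := by
    simp [Matrix.one_apply, ite_and]
  rw [hone]
  rcases Nat.eq_zero_or_pos (p : ℕ) with hp | hp
  · have hsum : ∀ q : Fin (d + 1), ¬ ((p : ℕ) = q + 1) := fun q => by omega
    simp only [hsum, if_false, zero_mul, Finset.sum_const_zero, sub_zero]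
    by_cases hr : p = r
    · subst hr
      simp [Theta]
    · have : ¬ r ≤ p := fun h => hr (Fin.ext (by have := Fin.le_def.1 h; omega))
      simp [hr, this]
  · -- the only block that contributes to the sum is the one just above the block row `p`
    obtain ⟨q, hq⟩ : ∃ q : Fin (d + 1), (p : ℕ) = q + 1 := ⟨⟨p - 1, by omega⟩, by simp; omega⟩
    rw [Finset.sum_eq_single q (fun q' _ hne => by
      have : ¬ ((p : ℕ) = q' + 1) := fun h => hne (Fin.ext (by omega))
      simp [this]) (by simp)]
    simp only [hq, if_true]
    by_cases hr : r ≤ q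
    · have hr' : (r : ℕ) ≤ q := Fin.le_def.1 hr
      have h1 : r ≤ p := Fin.le_def.2 (by omega)
      have h2 : p ≠ r := fun h => by subst h; omega
      simp only [hr, h1, h2, if_true, if_false]
      rw [← Matrix.mul_apply, show (q : ℕ) + 1 - r = (q - r) + 1 by omega, Theta,
        show d * t + r + (q - r) = d * t + q by omega, sub_self]
    · have hr' : (q : ℕ) < r := not_le.1 hr
      simp only [hr, if_false, mul_zero, Finset.sum_const_zero, sub_zero]
      by_cases h : p = r
      · subst h
        simp [hq, Theta]
      · have : ¬ r ≤ p := fun h' => h (Fin.ext (by have := Fin.le_def.1 h'; omega))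
        simp [h, this]

theorem inv_hatA (t : ℕ) : (S.hatA d t)⁻¹ = S.transitionMatrix d t :=
  Matrix.inv_eq_right_inv (S.hatA_mul_transitionMatrix d t)

theorem mul_firstBlock_apply {ι : Type*} (M : Matrix ι (Fin (d + 1) × Fin n) ℝ) (i : ι)
    (b : Fin n) : (M * firstBlock n d) i b = M i (0, b) := by
  simp [Matrix.mul_apply, firstBlock, ← Prod.mk_inj]

theorem lastBlock_mul_apply {ι : Type*} (M : Matrix (Fin (d + 1) × Fin n) ι ℝ) (a : Fin n)
    (j : ι) : (lastBlock n d * M) a j = M (Fin.last d, a) j := by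
  simp [Matrix.mul_apply, lastBlock, ← Prod.mk_inj]

theorem phi_eq (t : ℕ) : S.Phi d t = S.Theta (d * t) d := by
  ext a b
  rw [Phi, mul_firstBlock_apply, lastBlock_mul_apply, inv_hatA]
  simp [transitionMatrix]

/-- The response of the states `x_{dt}, …, x_{d(t+1)}` to disturbances of the dynamics when the
initial state is chosen such that the final state vanishes. -/
noncomputable def backwardMatrix (t : ℕ) :
    Matrix (Fin (d + 1) × Fin n) (Fin (d + 1) × Fin n) ℝ :=
  S.transitionMatrix d t - S.transitionMatrix d t * firstBlock n d * (S.Phi d t)⁻¹ *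
    lastBlock n d * S.transitionMatrix d t

variable {S d}

/-- Running the dynamics backward from a vanishing final state, a state depends on later
disturbances only. -/
theorem backwardMatrix_apply_eq_zero (hA : ∀ k, IsUnit (S.A k)) (t : ℕ)
    {p q : Fin (d + 1) × Fin n} (hpq : q.1 ≤ p.1) : S.backwardMatrix d t p q = 0 := by
  obtain ⟨p, a⟩ := p
  obtain ⟨q, b⟩ := q
  have hpq' : (q : ℕ) ≤ p := hpq
  have hq : (q : ℕ) ≤ d := by omega
  have hU (k j : ℕ) : IsUnit (S.Theta k j).det :=
    (Matrix.isUnit_iff_isUnit_det _).1 (isUnit_theta hA k j)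
  have e1 : S.Theta (d * t + q) (d - q) = S.Theta (d * t) d * (S.Theta (d * t) q)⁻¹ := by
    have := S.theta_add (d * t) q (d - q)
    rw [Nat.add_sub_cancel' hq] at this
    rw [this, Matrix.mul_nonsing_inv_cancel_right _ _ (hU _ _)]
  have e2 : S.Theta (d * t) p = S.Theta (d * t + q) (p - q) * S.Theta (d * t) q := by
    have := S.theta_add (d * t) q (p - q)
    rwa [Nat.add_sub_cancel' hpq'] at this
  have e3 : S.Theta (d * t) p * (S.Theta (d * t) d)⁻¹ * S.Theta (d * t + q) (d - q) =
      S.Theta (d * t + q) (p - q) := by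
    rw [e1, Matrix.mul_assoc, Matrix.nonsing_inv_mul_cancel_left _ _ (hU _ _), e2,
      Matrix.mul_nonsing_inv_cancel_right _ _ (hU _ _)]
  have hfirst (c : Fin n) : (S.transitionMatrix d t * firstBlock n d) (p, a) c =
      S.Theta (d * t) p a c := by
    rw [mul_firstBlock_apply]
    simp [transitionMatrix]
  have hlast (c : Fin n) : (lastBlock n d * S.transitionMatrix d t) c (q, b) =
      S.Theta (d * t + q) (d - q) c b := by
    rw [lastBlock_mul_apply]
    simp [transitionMatrix, Fin.le_last]
  have e4 : (S.transitionMatrix d t * firstBlock n d * (S.Phi d t)⁻¹ *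
      lastBlock n d * S.transitionMatrix d t) (p, a) (q, b) =
      (S.Theta (d * t) p * (S.Theta (d * t) d)⁻¹ * S.Theta (d * t + q) (d - q)) a b := by
    rw [Matrix.mul_assoc _ (lastBlock n d), Matrix.mul_apply, Matrix.mul_apply]
    refine Finset.sum_congr rfl fun c _ => ?_
    rw [hlast, Matrix.mul_apply, Matrix.mul_apply]
    simp only [hfirst, phi_eq]
  rw [backwardMatrix, Matrix.sub_apply, e4, e3]
  simp [transitionMatrix, hpq]

theorem hatC_mul_mul_hatB_apply_eq_zero (t : ℕ)
    {M : Matrix (Fin (d + 1) × Fin n) (Fin (d + 1) × Fin n) ℝ} {i : Fin d × Fin n}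
    {j : Fin d × Fin m}
    (hM : ∀ p q, (p.1 : ℕ) = i.1 → (q.1 : ℕ) = j.1 + 1 → M p q = 0) :
    (S.hatC d t * M * S.hatB d t) i j = 0 := by
  rw [Matrix.mul_apply]
  refine Finset.sum_eq_zero fun q _ => ?_
  by_cases hq : (q.1 : ℕ) = j.1 + 1
  · rw [Matrix.mul_apply, Finset.sum_eq_zero fun p _ => ?_, zero_mul]
    by_cases hp : (p.1 : ℕ) = i.1
    · rw [hM p q hp hq, mul_zero]
    · rw [hatC, Matrix.of_apply, if_neg (Ne.symm hp), zero_mul]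
  · rw [hatB, Matrix.of_apply, if_neg hq, mul_zero]

theorem del_sub_eq (t : ℕ) : S.Del d t - S.Xi d t * (S.Phi d t)⁻¹ * S.Gam d t =
    S.hatC d t * S.backwardMatrix d t * S.hatB d t := by
  simp only [Del, Xi, Gam, backwardMatrix, inv_hatA, Matrix.mul_sub, Matrix.sub_mul,
    Matrix.mul_assoc]

/-- The product of a strictly causal and an anti-causal response is strictly block triangular. -/
theorem transpose_del_mul_apply_eq_zero (hA : ∀ k, IsUnit (S.A k)) (t : ℕ)
    {i k : Fin d × Fin m} (hik : k.1 ≤ i.1) :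
    ((S.Del d t)ᵀ * (S.Del d t - S.Xi d t * (S.Phi d t)⁻¹ * S.Gam d t)) i k = 0 := by
  have hik' : (k.1 : ℕ) ≤ i.1 := hik
  rw [del_sub_eq, Matrix.mul_apply]
  refine Finset.sum_eq_zero fun j _ => ?_
  rcases Nat.lt_or_ge i.1 j.1 with hij | hij
  · rw [hatC_mul_mul_hatB_apply_eq_zero (i := j) (j := k), mul_zero]
    intro p q hp hq
    exact backwardMatrix_apply_eq_zero hA t (Fin.le_def.2 (by omega))
  · rw [Matrix.transpose_apply, Del, inv_hatA,
      hatC_mul_mul_hatB_apply_eq_zero (i := j) (j := i), zero_mul]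
    intro p q hp hq
    have : ¬ q.1 ≤ p.1 := fun h => by have := Fin.le_def.1 h; omega
    rw [transitionMatrix, Matrix.of_apply, if_neg this]

theorem det_diagR_add (t : ℕ) {N : Matrix (Fin d × Fin m) (Fin d × Fin m) ℝ}
    (hN : ∀ i k : Fin d × Fin m, k.1 ≤ i.1 → N i k = 0) :
    (S.diagR d t + N).det = (S.diagR d t).det := by
  have hR : (S.diagR d t).BlockTriangular Prod.fst := fun i j hij => by
    rw [diagR, Matrix.of_apply, if_neg hij.ne']
  have hNt : N.BlockTriangular Prod.fst := fun i j hij => hN i j hij.le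
  rw [(hR.add hNt).det_fintype, hR.det_fintype]
  refine Finset.prod_congr rfl fun k _ => congrArg Matrix.det ?_
  ext i j
  change S.diagR d t i.1 j.1 + N i.1 j.1 = S.diagR d t i.1 j.1
  rw [hN _ _ (j.2.trans i.2.symm).le, add_zero]

theorem posDef_diagR (hR : ∀ k, (S.R k).PosDef) (t : ℕ) : (S.diagR d t).PosDef := by
  have hform (x : Fin d × Fin m → ℝ) : quadForm (S.diagR d t) x =
      ∑ i : Fin d, quadForm (S.R (d * t + i)) fun a => x (i, a) := by
    simp only [quadForm, dotProduct, Matrix.mulVec, Fintype.sum_prod_type, diagR, Matrix.of_apply]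
    refine Finset.sum_congr rfl fun i _ => Finset.sum_congr rfl fun a _ => ?_
    rw [Finset.sum_eq_single i (fun j _ hj => by simp [hj.symm]) (by simp)]
    simp
  refine posDef_iff.2 ⟨?_, fun x hx => ?_⟩
  · ext i j
    rw [Matrix.transpose_apply, diagR, Matrix.of_apply, Matrix.of_apply]
    by_cases hij : i.1 = j.1
    · rw [if_pos hij, if_pos hij.symm, hij]
      exact congrFun (congrFun (posDef_iff.1 (hR _)).1 i.2) j.2
    · rw [if_neg hij, if_neg (Ne.symm hij)]
  · obtain ⟨⟨i, a⟩, hia⟩ := Function.ne_iff.1 hx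
    rw [hform]
    refine Finset.sum_pos' (fun j _ => (posSemidef_iff.1 (hR _).posSemidef).2 _)
      ⟨i, Finset.mem_univ i, (posDef_iff.1 (hR _)).2 _ fun h0 => hia (congrFun h0 a)⟩

theorem posDef_Rt (hR : ∀ k, (S.R k).PosDef) (t : ℕ) : (S.Rt d t).PosDef := by
  have := Matrix.posSemidef_conjTranspose_mul_self (S.Del d t)
  rw [Matrix.conjTranspose_eq_transpose_of_trivial] at this
  exact (posDef_diagR hR t).add_posSemidef this

theorem isUnit_det_phi (hA : ∀ k, IsUnit (S.A k)) (t : ℕ) : IsUnit (S.Phi d t).det := by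
  rw [phi_eq]
  exact (Matrix.isUnit_iff_isUnit_det _).1 (isUnit_theta hA _ _)

/-- `det Ã_t = det Φ_t · det R / det R̃_t`, and therefore `|det Ã_t| ≤ |det Φ_t|`: the correction
term in `Ã_t` can be large when `R_k` approaches singularity, but it does not increase volumes. -/
theorem abs_det_At_le (hR : ∀ k, (S.R k).PosDef) (hA : ∀ k, IsUnit (S.A k)) (t : ℕ) :
    |(S.At d t).det| ≤ |(S.Phi d t).det| := by
  have hRt := posDef_Rt (S := S) (d := d) hR t
  have h1 := det_sub_mul_inv_mul ((Matrix.isUnit_iff_isUnit_det _).1 hRt.isUnit)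
    (isUnit_det_phi (d := d) hA t) (S.Gam d t) ((S.Del d t)ᵀ * S.Xi d t)
  have e1 : S.Phi d t - S.Gam d t * (S.Rt d t)⁻¹ * ((S.Del d t)ᵀ * S.Xi d t) = S.At d t := by
    simp only [At, Matrix.mul_assoc]
  have e2 : S.Rt d t - (S.Del d t)ᵀ * S.Xi d t * (S.Phi d t)⁻¹ * S.Gam d t = S.diagR d t +
      (S.Del d t)ᵀ * (S.Del d t - S.Xi d t * (S.Phi d t)⁻¹ * S.Gam d t) := by
    simp only [Rt, Matrix.mul_sub, Matrix.mul_assoc]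
    abel
  rw [e1, e2, det_diagR_add t fun i k => transpose_del_mul_apply_eq_zero hA t] at h1
  have hle : (S.diagR d t).det ≤ (S.Rt d t).det :=
    det_le_det_add_transpose_mul_self (posDef_diagR hR t) _
  have hpos := hRt.det_pos
  have h2 := congrArg abs h1
  rw [abs_mul, abs_mul, abs_of_pos hpos, abs_of_pos (posDef_diagR hR t).det_pos] at h2
  have h3 := mul_le_mul_of_nonneg_left hle (abs_nonneg (S.Phi d t).det)
  nlinarith

/-! ### Bounds for the lifted data -/

theorem bounded_theta (hA : UniformlyBounded S.A) (j : ℕ) :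
    UniformlyBounded fun k => S.Theta k j := by
  induction j with
  | zero => exact UniformlyBounded.const 1
  | succ j ih => exact (hA.comp (· + j)).mul ih

theorem bounded_inv_hatA (hA : UniformlyBounded S.A) :
    UniformlyBounded fun t => (S.hatA d t)⁻¹ := by
  choose c hc0 hc using fun j => (bounded_theta hA j).exists_nonneg
  refine ⟨∑ j ∈ Finset.range (d + 1), c j, fun t p q => ?_⟩
  change |(S.hatA d t)⁻¹ p q| ≤ _
  have hsum : 0 ≤ ∑ j ∈ Finset.range (d + 1), c j := Finset.sum_nonneg fun j _ => hc0 j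
  rw [inv_hatA, transitionMatrix, Matrix.of_apply]
  split_ifs
  · exact (hc _ _ _ _).trans (Finset.single_le_sum (fun j _ => hc0 j)
      (Finset.mem_range.2 (by omega)))
  · rwa [abs_zero]

theorem bounded_hatB (hB : UniformlyBounded S.B) : UniformlyBounded (S.hatB d) := by
  obtain ⟨c, hc0, hc⟩ := hB.exists_nonneg
  refine ⟨c, fun t p q => ?_⟩
  rw [hatB, Matrix.of_apply]
  split_ifs
  · exact hc _ _ _
  · rwa [abs_zero]

theorem bounded_hatC (hC : UniformlyBounded S.C) : UniformlyBounded (S.hatC d) := by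
  obtain ⟨c, hc0, hc⟩ := hC.exists_nonneg
  refine ⟨c, fun t p q => ?_⟩
  rw [hatC, Matrix.of_apply]
  split_ifs
  · exact hc _ _ _
  · rwa [abs_zero]

theorem bounded_diagR (hR : UniformlyBounded S.R) : UniformlyBounded (S.diagR d) := by
  obtain ⟨c, hc0, hc⟩ := hR.exists_nonneg
  refine ⟨c, fun t p q => ?_⟩
  rw [diagR, Matrix.of_apply]
  split_ifs
  · exact hc _ _ _
  · rwa [abs_zero]

theorem bounded_C (hQ : ∀ k, (S.Q k).PosSemidef) (hQb : UniformlyBounded S.Q) :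
    UniformlyBounded S.C := by
  obtain ⟨c, hc, hle⟩ := hQb.quadForm_le
  refine UniformlyBounded.of_mulVec_le (c := c) fun k x => ?_
  rw [← quadForm_transpose_mul_self, C, transpose_psdSqrt, psdSqrt_mul_self (hQ k)]
  exact hle k x

theorem transpose_Qt (hR : ∀ k, (S.R k).PosDef) (t : ℕ) : (S.Qt d t)ᵀ = S.Qt d t := by
  have h := transpose_inv_of_symm (posDef_iff.1 (posDef_Rt (S := S) (d := d) hR t)).1
  simp only [Qt, Matrix.transpose_sub, Matrix.transpose_mul, Matrix.transpose_transpose, h,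
    Matrix.mul_assoc]

theorem isUniform (hQ : ∀ k, (S.Q k).PosSemidef) (hR : ∀ k, (S.R k).PosDef)
    (hAb : UniformlyBounded S.A) (hBb : UniformlyBounded S.B) (hQb : UniformlyBounded S.Q)
    (hRb : UniformlyBounded S.R) (hA : ∀ k, IsUnit (S.A k))
    {q b a : ℝ} (hq : 0 < q) (hb : 0 < b) (ha : 0 < a)
    (hQt : ∀ t x, q * (x ⬝ᵥ x) ≤ quadForm (S.Qt d t) x)
    (hBt : ∀ t x, b * (x ⬝ᵥ x) ≤ quadForm (S.Bt d t * (S.Bt d t)ᵀ) x)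
    (hAt : ∀ t x, a * (x ⬝ᵥ x) ≤ quadForm (S.At d t * (S.At d t)ᵀ) x) : S.IsUniform d := by
  have hinv := bounded_inv_hatA (d := d) hAb
  have hhB := bounded_hatB (d := d) hBb
  have hhC := bounded_hatC (d := d) (bounded_C hQ hQb)
  have hPhi : UniformlyBounded (S.Phi d) :=
    ((UniformlyBounded.const (lastBlock n d)).mul hinv).mul (UniformlyBounded.const _)
  have hGam : UniformlyBounded (S.Gam d) :=
    ((UniformlyBounded.const (lastBlock n d)).mul hinv).mul hhB
  have hXi : UniformlyBounded (S.Xi d) := (hhC.mul hinv).mul (UniformlyBounded.const _)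
  have hDel : UniformlyBounded (S.Del d) := (hhC.mul hinv).mul hhB
  have hunit (t : ℕ) : IsUnit (S.At d t).det := by
    have h1 := (posDef_of_lower_bound (by simp) ha (hAt t)).det_pos.ne'
    rw [Matrix.det_mul] at h1
    exact isUnit_iff_ne_zero.2 (left_ne_zero_of_mul h1)
  have hAinv : UniformlyBounded fun t => (S.At d t)⁻¹ := by
    have h1 : UniformlyBounded fun t => ((S.At d t)ᵀ)⁻¹ :=
      UniformlyBounded.of_mulVec_le (c := a⁻¹) fun t x => by
        have h2 := hAt t (((S.At d t)ᵀ)⁻¹ *ᵥ x)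
        rw [quadForm_mul_transpose_self, Matrix.mulVec_mulVec x (S.At d t)ᵀ,
          Matrix.mul_nonsing_inv _ (by rw [Matrix.det_transpose]; exact hunit t),
          Matrix.one_mulVec] at h2
        rwa [← div_eq_inv_mul, le_div_iff₀ ha, mul_comm]
    have h2 := h1.transpose
    simpa only [Matrix.transpose_nonsing_inv, Matrix.transpose_transpose] using h2
  refine
    { posDef_Rt := posDef_Rt hR
      transpose_Qt := transpose_Qt hR
      exists_le_Qt := ⟨q, hq, hQt⟩
      exists_le_Bt := ⟨b, hb, hBt⟩
      isUnit_At := fun t => (Matrix.isUnit_iff_isUnit_det _).2 (hunit t)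
      bounded_At := ?_
      bounded_inv_At := hAinv
      bounded_Bt := hGam
      bounded_Qt := ?_
      bounded_Rt := (bounded_diagR hRb).add (hDel.transpose.mul hDel) }
  · -- `Ã = det Ã · adj (Ã⁻¹)`, where both factors are bounded
    obtain ⟨c, hc⟩ := hPhi.abs_det_le
    have h1 := hAinv.adjugate.smul fun t => (abs_det_At_le hR hA t).trans (hc t)
    have e : (fun t => (S.At d t).det • (S.At d t)⁻¹.adjugate) = S.At d := by
      funext t
      have h2 := Matrix.mul_adjugate (S.At d t)⁻¹
      have h3 : (S.At d t).det * (S.At d t)⁻¹.det = 1 := by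
        rw [← Matrix.det_mul, Matrix.mul_nonsing_inv _ (hunit t), Matrix.det_one]
      calc (S.At d t).det • (S.At d t)⁻¹.adjugate
          = (S.At d t).det • (S.At d t * ((S.At d t)⁻¹ * (S.At d t)⁻¹.adjugate)) := by
            rw [Matrix.mul_nonsing_inv_cancel_left _ _ (hunit t)]
        _ = S.At d t := by rw [h2, Matrix.mul_smul, smul_smul, h3, one_smul, Matrix.mul_one]
    rwa [e] at h1
  · obtain ⟨c, hc, hle⟩ := hXi.mulVec_le
    refine UniformlyBounded.of_quadForm_le (fun t =>
      (posDef_of_lower_bound (transpose_Qt hR t) hq (hQt t)).posSemidef) (c := c) fun t x => ?_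
    refine le_trans ?_ (hle t x)
    have e : S.Qt d t = (S.Xi d t)ᵀ * S.Xi d t -
        ((S.Del d t)ᵀ * S.Xi d t)ᵀ * (S.Rt d t)⁻¹ * ((S.Del d t)ᵀ * S.Xi d t) := by
      simp only [Qt, Matrix.transpose_mul, Matrix.transpose_transpose, Matrix.mul_assoc]
    rw [e, quadForm_sub, quadForm_transpose_mul_self, quadForm_transpose_mul_mul]
    exact sub_le_self _ ((posSemidef_iff.1 (posDef_Rt hR t).inv.posSemidef).2 _)

end LQRData

namespace LQRData

theorem loss_constant_le {β l o ω v c : ℝ} (hβ : 0 < β) (hl : 0 < l) (ho : 0 < o) (hω : 0 < ω)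
    (hv : 0 < v) (hoω : o ≤ ω)
    (hc : 0 < β * l * o / (ω * v * ω) → c ≤ β * l * o / (ω * v * ω) + 1) :
    (c - 1) * v * (ω / l) ≤ β := by
  have h1 := sub_le_iff_le_add.2 (hc (by positivity))
  calc (c - 1) * v * (ω / l) = (c - 1) * (v * (ω / l)) := mul_assoc _ _ _
    _ ≤ β * l * o / (ω * v * ω) * (v * (ω / l)) := mul_le_mul_of_nonneg_right h1 (by positivity)
    _ = β * (o / ω) := by field_simp
    _ ≤ β := mul_le_of_le_one_right hβ.le ((div_le_one hω).2 hoω)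

end LQRData

theorem corollary1 {n m d : ℕ} (hn : 0 < n) (hm : 0 < m) (hd : 0 < d) (S : LQRData n m)
    (hQ : ∀ k, (S.Q k).PosSemidef) (hR : ∀ k, (S.R k).PosDef)
    -- bounded data
    (hbdd : ∃ a b q r : ℝ, ∀ k, LQR.norm2 (S.A k) ≤ a ∧ LQR.norm2 (S.B k) ≤ b ∧
      LQR.norm2 (S.Q k) ≤ q ∧ LQR.norm2 (S.R k) ≤ r)
    -- invertible state matrices
    (hA : ∀ k, IsUnit (S.A k))
    -- `d`-step controllability and observability
    (hctr : ∀ k, (S.ctrMatrix k d).rank = n)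
    (hobs : ∀ k, (S.obsMatrix k d).rank = n)
    -- uniformity
    (hQt : 0 < ⨅ t, LQR.lambdaMin (S.Qt d t))
    (hBt : 0 < ⨅ t, LQR.lambdaMin (S.Bt d t * (S.Bt d t)ᵀ))
    (hAt : 0 < ⨅ t, LQR.lambdaMin (S.At d t * (S.At d t)ᵀ))
    (T : ℕ) (hT : 0 < T) :
    -- the objects that the bound refers to are well defined
    (∃! P, S.IsBoundedRiccatiSolution d P) ∧ (∃! μ, S.IsRecedingHorizonPolicy d T μ) ∧
    ∀ P μ, S.IsBoundedRiccatiSolution d P → S.IsRecedingHorizonPolicy d T μ →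
      -- the constants are finite and positive
      (BddAbove (Set.range (S.omegaUpAt d T)) ∧ BddAbove (Set.range fun t => LQR.norm2 (P t)) ∧
        BddAbove (Set.range (S.deltaRatioAt d P T)) ∧ BddAbove (Set.range (S.zetaAt d))) ∧
      (0 < S.omegaUp d T ∧ 0 < S.omegaLow d T ∧ 0 < S.lambdaLow d T ∧ 0 < LQR.lambdaUp P ∧
        0 < S.deltaUp d P T ∧ 0 < S.zetaUp d ∧ 0 < S.epsLow d) ∧
      -- `Jrh` and `Jopt` are the infinite-horizon costs of the receding-horizon input and of the
      -- optimal input, and `Jrh - Jopt` is the performance loss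
      ∀ ξ : Fin n → ℝ, ∃ Jrh Jopt : ℝ,
        S.HasCost d ξ (S.clInput d μ ξ) Jrh ∧
        S.HasCost d ξ (S.clInput d (S.optPolicy d P) ξ) Jopt ∧
        (∀ u c, S.HasCost d ξ u c → Jopt ≤ c) ∧
        ∀ β : ℝ, 0 < β →
          Real.log (Real.log ((β * S.lambdaLow d T * S.omegaLow d T /
              (S.omegaUp d T * LQR.lambdaUp P * S.omegaUp d T) + 1) ^ (1 / S.deltaUp d P T))) /
            Real.log (S.zetaUp d / (S.zetaUp d + S.epsLow d)) + 1 ≤ (T : ℝ) →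
          Jrh - Jopt ≤ β * (ξ ⬝ᵥ ξ) := by
  obtain ⟨a, b, q, r, hb⟩ := hbdd
  have h : S.IsUniform d := LQRData.isUniform hQ hR
    (LQR.UniformlyBounded.of_norm2_le fun k => (hb k).1)
    (LQR.UniformlyBounded.of_norm2_le fun k => (hb k).2.1)
    (LQR.UniformlyBounded.of_norm2_le fun k => (hb k).2.2.1)
    (LQR.UniformlyBounded.of_norm2_le fun k => (hb k).2.2.2) hA hQt hBt hAt
    (LQR.lambdaMin_of_iInf_pos hQt) (LQR.lambdaMin_of_iInf_pos hBt)
    (LQR.lambdaMin_of_iInf_pos hAt)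
  refine ⟨h.existsUnique_isBoundedRiccatiSolution hn, ?_, fun P μ hP hμ => ?_⟩
  · exact ⟨_, (h.isRecedingHorizonPolicy_iff hT _).2 rfl,
      fun μ hμ => (h.isRecedingHorizonPolicy_iff hT μ).1 hμ⟩
  have hα := h.one_lt_iSup_deltaRatioAt hP hn T
  have hζ := h.zetaUp_pos hn
  have hε := h.epsLow_pos hn
  have hlow := h.lambdaLow_pos hn T
  have hωlow := h.omegaLow_pos hn T
  have hω : 0 < S.omegaUp d T := hωlow.trans_le (h.omegaLow_le_omegaUp hn hT)
  have hlam := h.lambdaUp_pos hP hn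
  have hρ0 : 0 < S.zetaUp d / (S.zetaUp d + S.epsLow d) :=
    div_pos hζ (add_pos hζ hε)
  have hρ1 : S.zetaUp d / (S.zetaUp d + S.epsLow d) < 1 :=
    (div_lt_one (add_pos hζ hε)).2 (lt_add_of_pos_right _ hε)
  have hδ : 0 < S.deltaUp d P T := by
    have hn' : (0 : ℝ) < n := Nat.cast_pos.2 hn
    rw [LQRData.deltaUp]
    exact mul_pos (Real.sqrt_pos.2 hn') (Real.log_pos hα)
  refine ⟨⟨h.omegaUpAt_bddAbove hT, LQRData.IsUniform.norm2_solution_bddAbove hP,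
    h.deltaRatioAt_bddAbove hP hn T, h.zetaAt_bddAbove⟩,
    ⟨hω, hωlow, hlow, hlam, hδ, hζ, hε⟩, fun ξ => ?_⟩
  obtain ⟨J, hJ, hloss⟩ := h.recedingHorizon_loss_le hP hn hT hμ
    (Real.one_le_rpow hα.le (pow_pos hρ0 (T - 1)).le)
    (h.hatXsucc_le_mul_solution hP hn hT) ξ
  refine ⟨J, LQR.quadForm (P 0) ξ, hJ, h.hasCost_optPolicy hP ξ,
    fun u c hc => h.solution_le_of_hasCost hP hc, fun β hβ hhor => hloss.trans ?_⟩
  refine mul_le_mul_of_nonneg_right ?_ (LQR.dotProduct_self_nonneg' ξ)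
  exact LQRData.loss_constant_le hβ hlow hωlow hω hlam (h.omegaLow_le_omegaUp hn hT)
    fun hy => LQRData.rpow_pow_le_of_horizon hn hT hρ0 hρ1 hα hy hhor
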